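/- **Setting.** Let $\mathcal X$ be a set of contexts and $\mathcal A$ a finite nonempty set of actions. Let $\mathbb D$ be a probability distribution over pairs $(x,\rho)$ of a context $x\in\mathcal X$ and a reward function $\rho:\mathcal X\times\mathcal A\to[0,1]$. The risk of a stochastic policy $\pi$ is $R(\pi)=1-\mathbb E_{(x,\rho)\sim\mathbb D}\,\mathbb E_{a\sim\pi(x)}[\rho(x,a)]$. Let $\pi_0$ be a fixed logging policy with full support, $\pi_0(a\mid x)>0$ for all $x,a$ (not necessarily known, nor of any parametric form). A dataset $S=(x_i,a_i,p_i,r_i)_{i=1}^n\sim(\mathbb D\times\pi_0)^n$ consists of $n$ independent examples with $(x_i,\rho_i)\sim\mathbb D$, $a_i\sim\pi_0(x_i)$, $p_i=\pi_0(a_i\mid x_i)$, $r_i=\rho_i(x_i,a_i)$. Let $\phi:\mathcal X\times\mathcal A\to\mathbb R^d$ satisfy $\|\phi(x,a)\|\le B$ for all $x,a$. For $\theta\in\mathbb R^d$ and $\gamma\in\mathbb R^{\mathcal A}$ let $h_{\theta,\gamma}(x)\in\arg\max_{a\in\mathcal A}\,\theta\cdot\phi(x,a)+\gamma_a$, and let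 $\varsigma_\theta(a\mid x)=\exp(\theta\cdot\phi(x,a))/\sum_{a'\in\mathcal A}\exp(\theta\cdot\phi(x,a'))$. For $\mu\in\mathbb R^d$ and $\sigma^2>0$, the mixed logit policy is $\pi_{\mu,\sigma^2}(a\mid x)=\Pr\{h_{\theta,\gamma}(x)=a\}$, where $\theta\sim\mathcal N(\mu,\sigma^2 I)$ and, independently, the $\gamma_{a'}$, $a'\in\mathcal A$, are independent standard Gumbel variables. For $\tau\in(0,1)$ put $$\hat R_\tau(\mu,\sigma^2,S)=1-\frac{\exp(-\tfrac12\sigma^2B^2)}{n}\sum_{i=1}^n r_i\,\frac{\varsigma_\mu(a_i\mid x_i)}{\max\{p_i,\tau\}}.$$ Let $\ell:\mathbb R^d\times\mathcal X\times\mathcal A\to[0,\infty)$ be convex and $L$-Lipschitz in its first argument, let $\lambda>0$, and let $$\hat\theta(S)=\arg\min_{\theta\in\mathbb R^d}\ \frac1n\sum_{i=1}^n\ell(\theta,x_i,a_i)+\lambda\|\theta\|^2 .$$ **Theorem.** For any $n\ge2$, $\delta\in(0,1)$, $\tau\in(0,1)$ and $\sigma_0^2\in(0,\infty)$, with probability at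 least $1-\delta$ over draws of $S\sim(\mathbb D\times\pi_0)^n$, the following holds simultaneously for all $\mu\in\mathbb R^d$ and $\sigma^2\in(0,\sigma_0^2]$: $$R(\pi_{\mu,\sigma^2})\le\hat R_\tau(\mu,\sigma^2,S)+\sqrt{\frac{\big(\hat R_\tau(\mu,\sigma^2,S)-1+\frac1\tau\big)\big(\hat\Gamma+2\ln\frac{2n}{\delta}\big)}{\tau(n-1)}}+\frac{\hat\Gamma+2\ln\frac{2n}{\delta}}{\tau(n-1)},$$ where $$\hat\Gamma=\frac{\Big(\|\mu-\hat\theta(S)\|+\frac L\lambda\sqrt{\frac{2\ln(4/\delta)}{n}}\Big)^2}{\sigma_0^2}+d\,\ln\frac{\sigma_0^2}{\sigma^2}.$$ -/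

import Mathlib

open MeasureTheory ProbabilityTheory
open scoped NNReal ENNReal

namespace BayesCRM

noncomputable section

/-- The parameter space `ℝ^d`, with the Euclidean norm. -/
abbrev Params (d : ℕ) : Type := EuclideanSpace ℝ (Fin d)

/-- A logged example `(x, a, p, r)`: context, action, propensity and observed reward. -/
abbrev Example (X A : Type*) : Type _ := X × A × ℝ × ℝ

/-! ### Mixed logit model -/

/-- The softmax policy `ς_θ(a | x)` with features `φ`. -/
def softmaxProb {X A : Type*} [Fintype A] {d : ℕ} (φ : X → A → Params d)
    (θ : Params d) (x : X) (a : A) : ℝ :=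
  Real.exp (inner ℝ θ (φ x a)) / ∑ a' : A, Real.exp (inner ℝ θ (φ x a'))

/-- The hypothesis `h_{θ,γ}(x) = argmax_a (θ · φ(x, a) + γ_a)`. Ties are broken by an arbitrary
fixed choice that depends only on the vector of scores. -/
def hypothesis {X A : Type*} [Fintype A] [Nonempty A] {d : ℕ} (φ : X → A → Params d)
    (w : Params d × (A → ℝ)) (x : X) : A :=
  (Finite.exists_max fun a : A => inner ℝ w.1 (φ x a) + w.2 a).choose

/-- The standard Gumbel distribution (location `0`, scale `1`), with density
`exp (-(t + exp (-t)))`. -/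
def stdGumbel : Measure ℝ :=
  volume.withDensity fun t => ENNReal.ofReal (Real.exp (-(t + Real.exp (-t))))

/-- The posterior `N(μ, σ² I) × Gumbel(0,1)^A` on the pairs `(θ, γ)`; here `v = σ²`. -/
def mixedLogitPosterior (A : Type*) [Fintype A] {d : ℕ} (μ : Params d) (v : ℝ) :
    Measure (Params d × (A → ℝ)) :=
  (multivariateGaussian μ (v • (1 : Matrix (Fin d) (Fin d) ℝ))).prod
    (Measure.pi fun _ : A => stdGumbel)

/-- The mixed logit policy: given `x`, the law of `h_{θ,γ}(x)` for `(θ, γ)` drawn from the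
posterior. -/
def mixedLogitPolicy {X A : Type*} [Fintype A] [Nonempty A] [MeasurableSpace A] {d : ℕ}
    (φ : X → A → Params d) (μ : Params d) (v : ℝ) (x : X) : Measure A :=
  (mixedLogitPosterior A μ v).map fun w => hypothesis φ w x

/-! ### Risk, logged data and the clipped estimator

A draw of a context and a reward function is a draw of `(x, ρ)` in `X × R` from `D`, where `R` is
a measurable space of reward functions and `rew ρ x a` is the value `ρ(x, a)`. -/

/-- The risk `1 - E_{(x,ρ) ∼ D} E_{a ∼ π(x)} [ρ(x, a)]` of a policy `π`. -/
def risk {X R A : Type*} [MeasurableSpace X] [MeasurableSpace R] [MeasurableSpace A]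
    (D : Measure (X × R)) (rew : R → X → A → ℝ) (π : X → Measure A) : ℝ :=
  1 - ∫ z, (∫ a, rew z.2 z.1 a ∂(π z.1)) ∂D

/-- The law of one logged example: `(x, ρ) ∼ D`, `a ∼ π₀(x)`, `p = π₀(a | x)`, `r = ρ(x, a)`. -/
def exampleLaw {X R A : Type*} [MeasurableSpace X] [MeasurableSpace R] [MeasurableSpace A]
    (D : Measure (X × R)) (rew : R → X → A → ℝ) (π₀ : Kernel X A) : Measure (Example X A) :=
  (D ⊗ₘ (π₀.comap Prod.fst measurable_fst)).map fun z =>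
    (z.1.1, z.2, (π₀ z.1.1).real {z.2}, rew z.1.2 z.1.1 z.2)

/-- The law of a dataset of `n` independent logged examples. -/
def dataLaw {X R A : Type*} [MeasurableSpace X] [MeasurableSpace R] [MeasurableSpace A]
    (D : Measure (X × R)) (rew : R → X → A → ℝ) (π₀ : Kernel X A) (n : ℕ) :
    Measure (Fin n → Example X A) :=
  Measure.pi fun _ => exampleLaw D rew π₀

/-- The mean-parameter clipped estimator
`1 - (exp (-σ² B² / 2) / n) ∑ i, r_i ς_μ(a_i | x_i) / max {p_i, τ}`; here `v = σ²`. -/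
def clippedRisk {X A : Type*} [Fintype A] {d n : ℕ} (φ : X → A → Params d) (B τ : ℝ)
    (μ : Params d) (v : ℝ) (S : Fin n → Example X A) : ℝ :=
  1 - Real.exp (-(1 / 2) * v * B ^ 2) / n *
    ∑ i : Fin n, (S i).2.2.2 *
      (softmaxProb φ μ (S i).1 (S i).2.1 / max (S i).2.2.1 τ)

/-! ### Regularized estimate of the logging policy -/

/-- The ridge-regularized empirical objective `(1/n) ∑ i, ℓ(θ, x_i, a_i) + λ ‖θ‖²`. -/
def rermObjective {X A : Type*} {d n : ℕ} (ℓ : Params d → X → A → ℝ) (lam : ℝ)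
    (θ : Params d) (S : Fin n → Example X A) : ℝ :=
  1 / n * ∑ i : Fin n, ℓ θ (S i).1 (S i).2.1 + lam * ‖θ‖ ^ 2

/-- The minimizer `θ̂(S)` of the regularized objective over `ℝ^d`. -/
def rerm {X A : Type*} {d n : ℕ} (ℓ : Params d → X → A → ℝ) (lam : ℝ)
    (S : Fin n → Example X A) : Params d :=
  Classical.epsilon fun θ => ∀ θ', rermObjective ℓ lam θ S ≤ rermObjective ℓ lam θ' S

/-- The complexity term
`(‖μ - θ̂‖ + (L/λ) √(2 ln(4/δ) / n))² / σ₀² + d ln (σ₀² / σ²)`; here `v₀ = σ₀²`, `v = σ²`. -/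
def klBound {d : ℕ} (n : ℕ) (L lam δ : ℝ) (θhat : Params d) (v₀ : ℝ) (μ : Params d) (v : ℝ) :
    ℝ :=
  (‖μ - θhat‖ + L / lam * √(2 * Real.log (4 / δ) / n)) ^ 2 / v₀ + d * Real.log (v₀ / v)

end

end BayesCRM

namespace BayesCRM

/-! The bound is a PAC-Bayes inequality with a data-independent Gaussian prior centred at `θbar`,
the mean of the regularized minimizer. This centre is unknown but deterministic, so it is a
legitimate prior mean; only its distance to the posterior mean μ enters the relative entropy. Strong
convexity makes `rerm` stable (`norm_rerm_update_sub_le`), so a Hilbert-space bounded differences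
inequality (`measureReal_norm_sub_integral_ge_le`) puts the observable `rerm ℓ lam S` near `θbar`,
in any dimension. The triangle inequality then replaces one by the other in `klBound`.

The PAC-Bayes inequality (`exists_pacBayes_event`) concerns losses in [0,1] and has a fast rate when
the empirical loss is small: their second moment is at most their mean, so Chernoff's bound controls
`gapDiv`, and Donsker–Varadhan transfers its exponential moment to all posteriors at once. It is
applied to τ times the clipped importance-weighted loss, shifted into [0,1].

Two facts link this loss to the mixed logit policy. By the Gumbel-max trick the policy is a Gaussian
mixture of softmax policies (`mixedLogitPolicy_real_singleton`), so only θ has to carry a posterior.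
By a Jensen argument that mixture is at least exp(-σ²B²/2) times the softmax at the mean
(`exp_mul_softmaxProb_le_integral`), which turns the posterior average into the explicit estimator.
Clipping a propensity can only underestimate the reward, so the resulting bias has the safe sign. -/

/-! ### Concentration of vector-valued functions with bounded differences -/

/-- Convexity of `s ↦ cosh √s`, along the segment from `(a - c)²` to `(a + c)²`. -/
lemma cosh_le_convex_combination {a c t y : ℝ} (ht : |t| ≤ 1)
    (hy : y ^ 2 ≤ a ^ 2 + c ^ 2 + 2 * (a * c * t)) :
    Real.cosh y ≤ (1 + t) / 2 * Real.cosh (a + c) + (1 - t) / 2 * Real.cosh (a - c) := by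
  obtain ⟨h1, h2⟩ := abs_le.1 ht
  have hs := ((Real.hasSum_cosh (a + c)).mul_left ((1 + t) / 2)).add
    ((Real.hasSum_cosh (a - c)).mul_left ((1 - t) / 2))
  -- The comparison is termwise in the series of y^(2k)/(2k)!, each term being a convex power of y².
  refine hasSum_le (fun k => ?_) (Real.hasSum_cosh y) hs
  have hconv := (convexOn_pow (𝕜 := ℝ) k).2 (Set.mem_Ici.2 (sq_nonneg (a + c)))
    (Set.mem_Ici.2 (sq_nonneg (a - c)))
    (by linarith : 0 ≤ (1 + t) / 2) (by linarith : 0 ≤ (1 - t) / 2) (by ring)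
  simp only [smul_eq_mul] at hconv
  have hle : (y ^ 2) ^ k
      ≤ ((1 + t) / 2 * (a + c) ^ 2 + (1 - t) / 2 * (a - c) ^ 2) ^ k := by
    apply pow_le_pow_left₀ (sq_nonneg y)
    linarith [hy]
  rw [pow_mul, pow_mul, pow_mul, ← mul_div_assoc, ← mul_div_assoc, ← add_div]
  gcongr
  exact hle.trans hconv

lemma integrable_cosh_norm_of_bound {E : Type*} [NormedAddCommGroup E] [MeasurableSpace E]
    [BorelSpace E] {Ω : Type*} [MeasurableSpace Ω] {P : Measure Ω}
    [IsFiniteMeasure P] {Y : Ω → E} (hY : Measurable Y) {c : ℝ} (hc : ∀ ω, ‖Y ω‖ ≤ c) :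
    Integrable (fun ω => Real.cosh ‖Y ω‖) P := by
  refine Integrable.of_bound (C := Real.cosh c)
    (Real.continuous_cosh.measurable.comp hY.norm).aestronglyMeasurable (.of_forall fun ω => ?_)
  rw [Real.norm_eq_abs, abs_of_pos (Real.cosh_pos _)]
  exact Real.cosh_le_cosh.2 (by
    rw [abs_of_nonneg (norm_nonneg _)]; exact (hc ω).trans (le_abs_self c))

section Concentration

variable {E : Type*} [NormedAddCommGroup E] [InnerProductSpace ℝ E] [CompleteSpace E]
  [MeasurableSpace E] [BorelSpace E] [SecondCountableTopology E]

/-- A bounded centred perturbation increases `E cosh ‖x‖` by a factor of at most `cosh c`. -/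
lemma integral_cosh_norm_add_le {Ω : Type*} [MeasurableSpace Ω] {P : Measure Ω}
    [IsProbabilityMeasure P] {Y : Ω → E} (hY : Measurable Y) {c : ℝ} (hc : ∀ ω, ‖Y ω‖ ≤ c)
    (hmean : ∫ ω, Y ω ∂P = 0) (x : E) :
    ∫ ω, Real.cosh ‖x + Y ω‖ ∂P ≤ Real.cosh c * Real.cosh ‖x‖ := by
  have hYint : Integrable Y P :=
    Integrable.of_bound hY.aestronglyMeasurable c (.of_forall hc)
  -- `t` is the cosine-like weight that makes the cross term of ‖x + Y‖² equal 2‖x‖c·t. If ‖x‖c = 0,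
  -- division by zero gives t = 0, consistent with a vanishing inner product.
  set t : Ω → ℝ := fun ω => inner ℝ x (Y ω) / (‖x‖ * c) with ht_def
  have hmul : ∀ ω, |inner ℝ x (Y ω)| ≤ ‖x‖ * c := fun ω =>
    (abs_real_inner_le_norm x (Y ω)).trans (mul_le_mul_of_nonneg_left (hc ω) (norm_nonneg x))
  have ht_abs : ∀ ω, |t ω| ≤ 1 := fun ω => by
    have h0 : 0 ≤ ‖x‖ * c := (abs_nonneg _).trans (hmul ω)
    rw [ht_def, abs_div, abs_of_nonneg h0]
    exact div_le_one_of_le₀ (hmul ω) h0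
  have ht_mul : ∀ ω, ‖x‖ * c * t ω = inner ℝ x (Y ω) := fun ω => by
    by_cases h : ‖x‖ * c = 0
    · have := hmul ω
      rw [h, abs_nonpos_iff] at this
      rw [h, this, zero_mul]
    · exact mul_div_cancel₀ _ h
  have ht_int : Integrable t P := (hYint.const_inner x).div_const _
  have ht_mean : ∫ ω, t ω ∂P = 0 := by
    rw [ht_def, integral_div, integral_inner hYint, hmean, inner_zero_right, zero_div]
  -- After the addition formulas the bound is affine in `t`, hence in Y, so centring removes its
  -- second term.
  have hpt : ∀ ω, Real.cosh ‖x + Y ω‖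
      ≤ Real.cosh c * Real.cosh ‖x‖ + t ω * (Real.sinh ‖x‖ * Real.sinh c) := fun ω => by
    have h := cosh_le_convex_combination (a := ‖x‖) (c := c) (t := t ω) (y := ‖x + Y ω‖)
      (ht_abs ω) (by
        rw [ht_mul, norm_add_sq_real]
        have := pow_le_pow_left₀ (norm_nonneg (Y ω)) (hc ω) 2
        linarith)
    rw [Real.cosh_add, Real.cosh_sub] at h
    linarith
  calc ∫ ω, Real.cosh ‖x + Y ω‖ ∂P
      ≤ ∫ ω, (Real.cosh c * Real.cosh ‖x‖ + t ω * (Real.sinh ‖x‖ * Real.sinh c)) ∂P :=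
        integral_mono (integrable_cosh_norm_of_bound (c := ‖x‖ + c) (hY.const_add x) fun ω =>
            (norm_add_le _ _).trans (by gcongr; exact hc ω))
          ((integrable_const _).add (ht_int.mul_const _)) hpt
    _ = Real.cosh c * Real.cosh ‖x‖ := by
        rw [integral_add (integrable_const _) (ht_int.mul_const _),
          integral_mul_const (Real.sinh ‖x‖ * Real.sinh c) t, ht_mean]
        simp

/-- Exponential moment bound for functions of independent variables with bounded differences. -/
lemma integral_cosh_norm_sub_integral_le {Z : Type*} [MeasurableSpace Z] (P : Measure Z)
    [IsProbabilityMeasure P] {c M : ℝ} :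
    ∀ (n : ℕ) (f : (Fin n → Z) → E), Measurable f → (∀ S, ‖f S‖ ≤ M) →
      (∀ S i z, ‖f (Function.update S i z) - f S‖ ≤ c) → ∀ x : E,
      ∫ S, Real.cosh ‖x + (f S - ∫ S', f S' ∂(Measure.pi fun _ => P))‖ ∂(Measure.pi fun _ => P)
        ≤ Real.cosh c ^ n * Real.cosh ‖x‖ := by
  intro n
  induction n with
  | zero =>
    intro f _ _ _ x
    have hf : ∀ S, f S = f default := fun S => congrArg f (Subsingleton.elim _ _)
    simp [hf]
  | succ n ih =>
    intro f hf hM hd x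
    let e := (MeasurableEquiv.piFinSuccAbove (fun _ : Fin (n + 1) => Z) 0).symm
    have he : MeasurePreserving e (P.prod (Measure.pi fun _ : Fin n => P))
        (Measure.pi fun _ => P) :=
      (measurePreserving_piFinSuccAbove (fun _ : Fin (n + 1) => P) 0).symm
    have he_apply : ∀ z S, e (z, S) = Fin.cons z S := fun z S =>
      Fin.insertNth_zero' (β := Z) z S
    have hF : Measurable fun p => f (e p) := hf.comp e.measurable
    have hFint : Integrable (fun p => f (e p)) (P.prod (Measure.pi fun _ : Fin n => P)) :=
      Integrable.of_bound hF.aestronglyMeasurable M (.of_forall fun _ => hM _)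
    -- `g` is the conditional mean given the first coordinate. The deviation splits as (f - g) + (g
    -- - m): the induction hypothesis treats the first part with shift x + (g - m), which is why the
    -- shift is quantified, and the one-step lemma treats the second.
    set g : Z → E := fun z => ∫ S, f (e (z, S)) ∂(Measure.pi fun _ : Fin n => P) with hg_def
    have hFz : ∀ z, Measurable fun S => f (e (z, S)) := fun z =>
      hF.comp (measurable_const.prodMk measurable_id)
    have hFzint : ∀ z, Integrable (fun S => f (e (z, S))) (Measure.pi fun _ : Fin n => P) :=
      fun z => Integrable.of_bound (hFz z).aestronglyMeasurable M (.of_forall fun _ => hM _)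
    have hg : Measurable g :=
      (hF.stronglyMeasurable.integral_prod_right').measurable
    have hgM : ∀ z, ‖g z‖ ≤ M := fun z => by
      simpa using norm_integral_le_of_norm_le_const (μ := Measure.pi fun _ : Fin n => P)
        (f := fun S => f (e (z, S))) (.of_forall fun _ => hM _)
    have hgint : Integrable g P := Integrable.of_bound hg.aestronglyMeasurable M (.of_forall hgM)
    have hmean : ∫ S, f S ∂(Measure.pi fun _ => P) = ∫ z, g z ∂P := by
      rw [← he.integral_comp', integral_prod _ hFint]
    set m := ∫ z, g z ∂P with hm
    have hgdiff : ∀ z z', ‖g z - g z'‖ ≤ c := fun z z' => by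
      rw [hg_def]
      simp only
      rw [← integral_sub (hFzint z) (hFzint z')]
      refine (norm_integral_le_of_norm_le_const (C := c) (.of_forall fun S => ?_)).trans (by simp)
      have h := hd (e (z', S)) 0 z
      rwa [he_apply, Fin.update_cons_zero, ← he_apply, ← he_apply] at h
    have hgc : ∀ z, ‖g z - m‖ ≤ c := fun z => by
      have : g z - m = ∫ z', (g z - g z') ∂P := by
        rw [integral_sub (integrable_const _) hgint]; simp [hm]
      rw [this]
      exact (norm_integral_le_of_norm_le_const (C := c) (.of_forall fun z' => hgdiff z z')).trans
        (by simp)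
    have hmM : ‖m‖ ≤ M := by
      simpa using norm_integral_le_of_norm_le_const (μ := P) (.of_forall hgM)
    have hbig : Integrable (fun p => Real.cosh ‖x + (f (e p) - m)‖)
        (P.prod (Measure.pi fun _ : Fin n => P)) :=
      integrable_cosh_norm_of_bound (c := ‖x‖ + (M + M)) ((hF.sub_const m).const_add x) fun p =>
        (norm_add_le _ _).trans (by
          gcongr
          exact (norm_sub_le _ _).trans (add_le_add (hM _) hmM))
    rw [hmean, ← he.integral_comp' (g := fun S => Real.cosh ‖x + (f S - m)‖), integral_prod _ hbig]
    have hinner : ∀ z, ∫ S, Real.cosh ‖x + (f (e (z, S)) - m)‖ ∂(Measure.pi fun _ : Fin n => P)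
        ≤ Real.cosh c ^ n * Real.cosh ‖x + (g z - m)‖ := fun z => by
      have h := ih (fun S => f (e (z, S))) (hFz z) (fun S => hM _) (fun S i w => by
        have h := hd (e (z, S)) i.succ w
        rwa [he_apply, ← Fin.cons_update, ← he_apply, ← he_apply] at h) (x + (g z - m))
      refine le_trans (le_of_eq ?_) h
      congr 1; ext S; congr 2
      simp only [hg_def]; abel
    have hgcosh : Integrable (fun z => Real.cosh ‖x + (g z - m)‖) P :=
      integrable_cosh_norm_of_bound (c := ‖x‖ + c) ((hg.sub_const m).const_add x) fun z =>
        (norm_add_le _ _).trans (by gcongr; exact hgc z)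
    calc _ ≤ ∫ z, Real.cosh c ^ n * Real.cosh ‖x + (g z - m)‖ ∂P :=
          integral_mono hbig.integral_prod_left (hgcosh.const_mul _) hinner
      _ = Real.cosh c ^ n * ∫ z, Real.cosh ‖x + (g z - m)‖ ∂P := integral_const_mul _ _
      _ ≤ Real.cosh c ^ n * (Real.cosh c * Real.cosh ‖x‖) := by
          gcongr
          refine integral_cosh_norm_add_le (hg.sub_const m) hgc ?_ x
          rw [integral_sub hgint (integrable_const _)]; simp [hm]
      _ = _ := by ring

/-- Bounded differences inequality in a Hilbert space. -/
theorem measureReal_norm_sub_integral_ge_le {Z : Type*} [MeasurableSpace Z] (P : Measure Z)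
    [IsProbabilityMeasure P] {c M : ℝ} {n : ℕ} (hn : 0 < n) (hc : 0 < c)
    {f : (Fin n → Z) → E} (hf : Measurable f) (hM : ∀ S, ‖f S‖ ≤ M)
    (hd : ∀ S i z, ‖f (Function.update S i z) - f S‖ ≤ c) {r : ℝ} (hr : 0 ≤ r) :
    (Measure.pi fun _ => P).real {S | r ≤ ‖f S - ∫ S', f S' ∂(Measure.pi fun _ => P)‖}
      ≤ 2 * Real.exp (-(r ^ 2 / (2 * n * c ^ 2))) := by
  have hn' : (0 : ℝ) < n := Nat.cast_pos.2 hn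
  set Q := Measure.pi fun _ : Fin n => P
  set m := ∫ S', f S' ∂Q with hm
  -- This scale minimizes n(sc)²/2 - sr. The factor 2 in the conclusion comes from cosh ≥ exp/2.
  set s : ℝ := r / (n * c ^ 2) with hs_def
  have hs : 0 ≤ s := by positivity
  have hmom := integral_cosh_norm_sub_integral_le P (c := s * c) (M := s * M) n
    (fun S => s • f S) (hf.const_smul s)
    (fun S => by rw [norm_smul, Real.norm_of_nonneg hs]; gcongr; exact hM S)
    (fun S i z => by
      rw [← smul_sub, norm_smul, Real.norm_of_nonneg hs]; gcongr; exact hd S i z) 0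
  simp only [zero_add, norm_zero, Real.cosh_zero, mul_one, integral_smul, ← smul_sub,
    norm_smul, Real.norm_of_nonneg hs] at hmom
  have hmM : ‖m‖ ≤ M := by
    simpa using norm_integral_le_of_norm_le_const (μ := Q) (.of_forall hM)
  have hint : Integrable (fun S => Real.cosh (s * ‖f S - m‖)) Q := by
    have := integrable_cosh_norm_of_bound (P := Q) (c := s * (M + M))
      (Y := fun S => s • (f S - m)) ((hf.sub_const m).const_smul s) (fun S => by
        rw [norm_smul, Real.norm_of_nonneg hs]; gcongr
        exact (norm_sub_le _ _).trans (add_le_add (hM _) hmM))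
    simpa only [norm_smul, Real.norm_of_nonneg hs] using this
  have hmarkov := mul_meas_ge_le_integral_of_nonneg
    (.of_forall fun S => (Real.cosh_pos (s * ‖f S - m‖)).le) hint (Real.exp (s * r) / 2)
  have hsub : Q.real {S | r ≤ ‖f S - m‖}
      ≤ Q.real {S | Real.exp (s * r) / 2 ≤ Real.cosh (s * ‖f S - m‖)} := by
    refine measureReal_mono fun S hS => ?_
    have h1 : Real.exp (s * r) ≤ Real.exp (s * ‖f S - m‖) :=
      Real.exp_le_exp.2 (mul_le_mul_of_nonneg_left hS hs)
    simp only [Set.mem_ofPred_eq, Real.cosh_eq]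
    linarith [Real.exp_pos (-(s * ‖f S - m‖))]
  have hcosh : Real.cosh (s * c) ^ n ≤ Real.exp (n * ((s * c) ^ 2 / 2)) := by
    rw [Real.exp_nat_mul]
    exact pow_le_pow_left₀ (Real.cosh_pos _).le (Real.cosh_le_exp_half_sq _) _
  have hexp : Real.exp (s * r) / 2 * Q.real {S | r ≤ ‖f S - m‖}
      ≤ Real.exp (n * ((s * c) ^ 2 / 2)) :=
    (mul_le_mul_of_nonneg_left hsub (by positivity)).trans
      (hmarkov.trans (hmom.trans hcosh))
  have key : n * ((s * c) ^ 2 / 2) = -(r ^ 2 / (2 * n * c ^ 2)) + s * r := by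
    rw [hs_def]; field_simp; ring
  rw [key, Real.exp_add] at hexp
  have hpos := Real.exp_pos (s * r)
  refine le_of_mul_le_mul_left (a := Real.exp (s * r) / 2) ?_ (by positivity)
  linarith

end Concentration

/-! ### Regularized empirical risk minimization -/

/-- Quadratic growth of a strongly convex function around its minimizer. -/
lemma StrongConvexOn.add_norm_sub_sq_le_of_forall_le {E : Type*} [NormedAddCommGroup E]
    [NormedSpace ℝ E] {F : E → ℝ} {m : ℝ} (hF : StrongConvexOn Set.univ m F)
    {x : E} (hx : ∀ y, F x ≤ F y) (y : E) : F x + m / 2 * ‖y - x‖ ^ 2 ≤ F y := by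
  by_contra! hlt
  set D := m / 2 * ‖y - x‖ ^ 2
  have hD : 0 < D := by linarith [hx y]
  -- Strong convexity on the segment, divided by `t`. Letting t → 0 would conclude; the explicit `t`
  -- below already suffices, since it makes the left side the midpoint of D and F y - F x.
  have key : ∀ t ∈ Set.Ioo (0 : ℝ) 1, (1 - t) * D ≤ F y - F x := fun t ht => by
    have h1 := hF.2 (Set.mem_univ y) (Set.mem_univ x) ht.1.le
      (by linarith [ht.2] : 0 ≤ 1 - t) (by ring)
    simp only [smul_eq_mul] at h1
    have h2 := hx (t • y + (1 - t) • x)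
    have h3 : t * ((1 - t) * D) ≤ t * (F y - F x) := by
      have : t * (1 - t) * (m / 2 * ‖y - x‖ ^ 2) = t * ((1 - t) * D) := mul_assoc _ _ _
      linarith
    exact le_of_mul_le_mul_left h3 ht.1
  have hgap : 0 ≤ F y - F x := by linarith [hx y]
  have ht1 : (D - (F y - F x)) / (2 * D) < 1 := by
    rw [div_lt_one (by positivity)]; linarith
  have ht0 : 0 < (D - (F y - F x)) / (2 * D) := div_pos (by linarith) (by positivity)
  have h := key _ ⟨ht0, ht1⟩
  have : (1 - (D - (F y - F x)) / (2 * D)) * D = (D + (F y - F x)) / 2 := by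
    field_simp; ring
  linarith

section Rerm

variable {X A : Type*} {d n : ℕ} {ℓ : Params d → X → A → ℝ} {lam : ℝ}

lemma strongConvexOn_rermObjective (hℓ_convex : ∀ x a, ConvexOn ℝ Set.univ fun θ => ℓ θ x a)
    (S : Fin n → Example X A) :
    StrongConvexOn Set.univ (2 * lam) fun θ => rermObjective ℓ lam θ S := by
  rw [strongConvexOn_iff_convex]
  have hsum : ConvexOn ℝ Set.univ fun θ : Params d => ∑ i : Fin n, ℓ θ (S i).1 (S i).2.1 := by
    refine ⟨convex_univ, fun x hx y hy a b ha hb hab => ?_⟩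
    simp only [Finset.smul_sum]
    rw [← Finset.sum_add_distrib]
    exact Finset.sum_le_sum fun i _ => (hℓ_convex _ _).2 hx hy ha hb hab
  have h := hsum.smul (c := (1 / n : ℝ)) (by positivity)
  refine h.congr fun θ _ => ?_
  simp only [rermObjective, smul_eq_mul]
  ring

variable {L : ℝ≥0}

lemma continuous_rermObjective (hℓ_lip : ∀ x a, LipschitzWith L fun θ => ℓ θ x a)
    (S : Fin n → Example X A) : Continuous fun θ => rermObjective ℓ lam θ S := by
  have : ∀ i, Continuous fun θ => ℓ θ (S i).1 (S i).2.1 := fun i => (hℓ_lip _ _).continuous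
  unfold rermObjective
  fun_prop

/-- Nonnegativity of the loss and the ridge term make the objective coercive, so a minimizer exists
and the `epsilon` choice in `rerm` is genuine. -/
lemma rerm_le (hℓ_nonneg : ∀ θ x a, 0 ≤ ℓ θ x a)
    (hℓ_lip : ∀ x a, LipschitzWith L fun θ => ℓ θ x a) (hlam : 0 < lam)
    (S : Fin n → Example X A) (θ : Params d) :
    rermObjective ℓ lam (rerm ℓ lam S) S ≤ rermObjective ℓ lam θ S := by
  have hex : ∃ θ, ∀ θ', rermObjective ℓ lam θ S ≤ rermObjective ℓ lam θ' S := by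
    refine (continuous_rermObjective hℓ_lip S).exists_forall_le ?_
    have hbound : ∀ θ : Params d, lam * ‖θ‖ ^ 2 ≤ rermObjective ℓ lam θ S := fun θ =>
      le_add_of_nonneg_left (mul_nonneg (by positivity)
        (Finset.sum_nonneg fun i _ => hℓ_nonneg _ _ _))
    exact Filter.tendsto_atTop_mono hbound (((Filter.tendsto_pow_atTop two_ne_zero).comp
      (tendsto_norm_cocompact_atTop (E := Params d))).const_mul_atTop hlam)
  exact Classical.epsilon_spec hex θ

/-- The source of uniqueness, boundedness, stability and measurability of the minimizer. The ridge
term has modulus 2λ, so the growth constant is λ. -/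
lemma rerm_quadratic_growth (hℓ_nonneg : ∀ θ x a, 0 ≤ ℓ θ x a)
    (hℓ_convex : ∀ x a, ConvexOn ℝ Set.univ fun θ => ℓ θ x a)
    (hℓ_lip : ∀ x a, LipschitzWith L fun θ => ℓ θ x a) (hlam : 0 < lam)
    (S : Fin n → Example X A) (θ : Params d) :
    rermObjective ℓ lam (rerm ℓ lam S) S + lam * ‖θ - rerm ℓ lam S‖ ^ 2
      ≤ rermObjective ℓ lam θ S := by
  have h := StrongConvexOn.add_norm_sub_sq_le_of_forall_le
    (strongConvexOn_rermObjective (lam := lam) hℓ_convex S)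
    (rerm_le hℓ_nonneg hℓ_lip hlam S) θ
  rwa [mul_div_cancel_left₀ _ two_ne_zero] at h

lemma loss_sub_le (hℓ_lip : ∀ x a, LipschitzWith L fun θ => ℓ θ x a) (θ θ' : Params d) (x : X)
    (a : A) : ℓ θ x a - ℓ θ' x a ≤ L * ‖θ - θ'‖ := by
  have h := (hℓ_lip x a).dist_le_mul θ θ'
  rw [Real.dist_eq, dist_eq_norm] at h
  exact (le_abs_self _).trans h

/-- Growth compared at θ = 0 gives 2λ‖θ‖² ≤ L‖θ‖. The bound supplies integrability, and it forces
the minimizer to vanish when L = 0. -/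
lemma norm_rerm_le (hn : 0 < n) (hℓ_nonneg : ∀ θ x a, 0 ≤ ℓ θ x a)
    (hℓ_convex : ∀ x a, ConvexOn ℝ Set.univ fun θ => ℓ θ x a)
    (hℓ_lip : ∀ x a, LipschitzWith L fun θ => ℓ θ x a) (hlam : 0 < lam)
    (S : Fin n → Example X A) : ‖rerm ℓ lam S‖ ≤ L / lam := by
  have hn' : (0 : ℝ) < n := Nat.cast_pos.2 hn
  have h := rerm_quadratic_growth hℓ_nonneg hℓ_convex hℓ_lip hlam S 0
  set θ := rerm ℓ lam S
  have hsum : ∑ i : Fin n, (ℓ 0 (S i).1 (S i).2.1 - ℓ θ (S i).1 (S i).2.1)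
      ≤ n * (L * ‖θ‖) := by
    refine (Finset.sum_le_card_nsmul _ _ (L * ‖θ‖) fun i _ => ?_).trans (by simp)
    simpa using loss_sub_le hℓ_lip 0 θ (S i).1 (S i).2.1
  rw [Finset.sum_sub_distrib] at hsum
  have hsum' := mul_le_mul_of_nonneg_left hsum (by positivity : (0 : ℝ) ≤ 1 / n)
  rw [← mul_assoc, one_div_mul_cancel hn'.ne', one_mul, mul_sub] at hsum'
  simp only [rermObjective, zero_sub, norm_neg, norm_zero] at h
  rw [le_div_iff₀ hlam]
  by_contra! hlt
  have hpos : 0 < ‖θ‖ := by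
    by_contra! h0
    have : ‖θ‖ = 0 := le_antisymm h0 (norm_nonneg _)
    rw [this, zero_mul] at hlt
    exact absurd hlt (not_lt.2 L.coe_nonneg)
  nlinarith [mul_lt_mul_of_pos_right hlt hpos, mul_pos hlam (pow_pos hpos 2)]

/-- Uniform stability of the regularized minimizer. -/
lemma norm_rerm_update_sub_le (hn : 0 < n)
    (hℓ_nonneg : ∀ θ x a, 0 ≤ ℓ θ x a)
    (hℓ_convex : ∀ x a, ConvexOn ℝ Set.univ fun θ => ℓ θ x a)
    (hℓ_lip : ∀ x a, LipschitzWith L fun θ => ℓ θ x a) (hlam : 0 < lam)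
    (S : Fin n → Example X A) (i : Fin n) (z : Example X A) :
    ‖rerm ℓ lam (Function.update S i z) - rerm ℓ lam S‖ ≤ L / (n * lam) := by
  have hn' : (0 : ℝ) < n := Nat.cast_pos.2 hn
  set S' := Function.update S i z with hS'
  have h1 := rerm_quadratic_growth hℓ_nonneg hℓ_convex hℓ_lip hlam S (rerm ℓ lam S')
  have h2 := rerm_quadratic_growth hℓ_nonneg hℓ_convex hℓ_lip hlam S' (rerm ℓ lam S)
  set θ := rerm ℓ lam S
  set θ' := rerm ℓ lam S'
  have hdiff : ∀ η : Params d, ∑ j, ℓ η (S' j).1 (S' j).2.1 - ∑ j, ℓ η (S j).1 (S j).2.1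
      = ℓ η z.1 z.2.1 - ℓ η (S i).1 (S i).2.1 := fun η => by
    rw [← Finset.sum_sub_distrib, Finset.sum_eq_single i]
    · simp [hS']
    · intro j _ hj
      simp [hS', Function.update_of_ne hj]
    · simp
  have e1 := hdiff θ
  have e2 := hdiff θ'
  have l1 := loss_sub_le hℓ_lip θ' θ (S i).1 (S i).2.1
  have l2 := loss_sub_le hℓ_lip θ θ' z.1 z.2.1
  rw [norm_sub_rev θ θ'] at h2 l2
  simp only [rermObjective] at h1 h2
  -- Adding the two growth inequalities cancels the ridge terms and every example except the
  -- replaced one, leaving two Lipschitz differences.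
  have h3 : 2 * (lam * ‖θ' - θ‖ ^ 2) ≤ 1 / n * (2 * (L * ‖θ' - θ‖)) := by
    have hm : 1 / (n : ℝ) * (∑ j, ℓ θ' (S j).1 (S j).2.1 - ∑ j, ℓ θ (S j).1 (S j).2.1
        + ∑ j, ℓ θ (S' j).1 (S' j).2.1 - ∑ j, ℓ θ' (S' j).1 (S' j).2.1)
        ≤ 1 / n * (2 * (L * ‖θ' - θ‖)) := by
      gcongr
      linarith
    linarith
  rcases (norm_nonneg (θ' - θ)).eq_or_lt with h0 | h0
  · rw [← h0]; positivity
  · rw [le_div_iff₀ (by positivity)]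
    have h4 : n * (2 * (lam * ‖θ' - θ‖ ^ 2)) ≤ 2 * (L * ‖θ' - θ‖) := by
      have := mul_le_mul_of_nonneg_left h3 hn'.le
      rwa [← mul_assoc (n : ℝ) (1 / n), mul_one_div_cancel hn'.ne', one_mul] at this
    refine le_of_mul_le_mul_right ?_ h0
    linarith

/-- The best of the first points of a dense sequence. -/
noncomputable def rermApprox (ℓ : Params d → X → A → ℝ) (lam : ℝ) (S : Fin n → Example X A) :
    ℕ → Params d
  | 0 => 0
  | k + 1 =>
    if rermObjective ℓ lam (TopologicalSpace.denseSeq (Params d) k) S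
        < rermObjective ℓ lam (rermApprox ℓ lam S k) S
      then TopologicalSpace.denseSeq (Params d) k else rermApprox ℓ lam S k

lemma rermObjective_rermApprox_le (S : Fin n → Example X A) {j k : ℕ} (hjk : j < k) :
    rermObjective ℓ lam (rermApprox ℓ lam S k) S
      ≤ rermObjective ℓ lam (TopologicalSpace.denseSeq (Params d) j) S := by
  induction k with
  | zero => omega
  | succ k ih =>
    rw [rermApprox]
    split_ifs with h
    · rcases Nat.lt_succ_iff_lt_or_eq.1 hjk with h' | rfl
      · exact h.le.trans (ih h')
      · exact le_rfl
    · rcases Nat.lt_succ_iff_lt_or_eq.1 hjk with h' | rfl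
      · exact ih h'
      · exact not_lt.1 h

/-- Density and continuity make the approximants nearly minimal in value; quadratic growth turns
this into closeness in norm. -/
lemma tendsto_rermApprox (hℓ_nonneg : ∀ θ x a, 0 ≤ ℓ θ x a)
    (hℓ_convex : ∀ x a, ConvexOn ℝ Set.univ fun θ => ℓ θ x a)
    (hℓ_lip : ∀ x a, LipschitzWith L fun θ => ℓ θ x a) (hlam : 0 < lam)
    (S : Fin n → Example X A) :
    Filter.Tendsto (rermApprox ℓ lam S) Filter.atTop (nhds (rerm ℓ lam S)) := by
  rw [Metric.tendsto_atTop]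
  intro ε hε
  have hopen : IsOpen {θ | rermObjective ℓ lam θ S
      < rermObjective ℓ lam (rerm ℓ lam S) S + lam * ε ^ 2} :=
    isOpen_lt (continuous_rermObjective hℓ_lip S) continuous_const
  obtain ⟨j, hj⟩ := (TopologicalSpace.denseRange_denseSeq (Params d)).exists_mem_open hopen
    ⟨rerm ℓ lam S, by simp only [Set.mem_ofPred_eq]; linarith [mul_pos hlam (pow_pos hε 2)]⟩
  refine ⟨j + 1, fun k hk => ?_⟩
  have h1 := rermObjective_rermApprox_le (ℓ := ℓ) (lam := lam) S (Nat.lt_of_succ_le hk)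
  have h2 := rerm_quadratic_growth hℓ_nonneg hℓ_convex hℓ_lip hlam S (rermApprox ℓ lam S k)
  simp only [Set.mem_ofPred_eq] at hj
  have h3 : lam * ‖rermApprox ℓ lam S k - rerm ℓ lam S‖ ^ 2 < lam * ε ^ 2 := by linarith
  rw [dist_eq_norm]
  exact lt_of_pow_lt_pow_left₀ 2 hε.le (lt_of_mul_lt_mul_left h3 hlam.le)

/-! ### Measurability of the regularized minimizer. -/

variable [MeasurableSpace X] [MeasurableSpace A] [Countable A] [MeasurableSingletonClass A]

lemma measurable_uncurry_rermObjective
    (hℓ_meas : ∀ θ a, Measurable fun x => ℓ θ x a)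
    (hℓ_lip : ∀ x a, LipschitzWith L fun θ => ℓ θ x a) :
    Measurable (Function.uncurry fun (θ : Params d) (S : Fin n → Example X A) =>
      rermObjective ℓ lam θ S) := by
  refine measurable_uncurry_of_continuous_of_measurable
    (fun S => continuous_rermObjective hℓ_lip S) fun θ => ?_
  have h1 : Measurable fun p : X × A => ℓ θ p.1 p.2 :=
    measurable_from_prod_countable_left fun a => hℓ_meas θ a
  have h2 : ∀ i : Fin n, Measurable fun S : Fin n → Example X A => ℓ θ (S i).1 (S i).2.1 :=
    fun i => h1.comp (by fun_prop : Measurable fun S : Fin n → Example X A => ((S i).1, (S i).2.1))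
  unfold rermObjective
  fun_prop

/-- An `epsilon` choice carries no measurability of its own; it is recovered here from a pointwise
limit of measurable selections. -/
lemma measurable_rerm (hℓ_nonneg : ∀ θ x a, 0 ≤ ℓ θ x a)
    (hℓ_meas : ∀ θ a, Measurable fun x => ℓ θ x a)
    (hℓ_convex : ∀ x a, ConvexOn ℝ Set.univ fun θ => ℓ θ x a)
    (hℓ_lip : ∀ x a, LipschitzWith L fun θ => ℓ θ x a) (hlam : 0 < lam) :
    Measurable (rerm (n := n) ℓ lam) := by
  have hF := measurable_uncurry_rermObjective (n := n) (lam := lam) hℓ_meas hℓ_lip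
  have happrox : ∀ k, Measurable fun S : Fin n → Example X A => rermApprox ℓ lam S k := by
    intro k
    induction k with
    | zero => exact measurable_const
    | succ k ih =>
      refine Measurable.ite (measurableSet_lt ?_ ?_) measurable_const ih
      · exact hF.comp (measurable_const.prodMk measurable_id)
      · exact hF.comp (ih.prodMk measurable_id)
  exact measurable_of_tendsto_metrizable happrox
    (tendsto_pi_nhds.2 fun S => tendsto_rermApprox hℓ_nonneg hℓ_convex hℓ_lip hlam S)

end Rerm

/-! ### A PAC-Bayes inequality for small risks -/

/-- The one-sided divergence `(b - a)₊² / (2 b)` between an empirical mean `a` and a mean `b`. -/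
noncomputable def gapDiv (a b : ℝ) : ℝ := (max (b - a) 0) ^ 2 / (2 * b)

lemma gapDiv_nonneg {a b : ℝ} (hb : 0 ≤ b) : 0 ≤ gapDiv a b := by
  unfold gapDiv; positivity

lemma gapDiv_le_one {a b : ℝ} (ha : 0 ≤ a) (hb : b ∈ Set.Icc (0 : ℝ) 1) : gapDiv a b ≤ 1 := by
  obtain ⟨h0, h1⟩ := hb
  refine div_le_one_of_le₀ ?_ (by positivity)
  have : max (b - a) 0 ≤ b := max_le (by linarith) h0
  nlinarith [pow_le_pow_left₀ (le_max_right (b - a) 0) this 2]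

/-- For b > 0 the supremum of the left side over s ≥ 0 is `gapDiv`. Being linear in (a, b), these
minorants can be averaged over parameters, which takes the place of Jensen's inequality for
`gapDiv`. -/
lemma linear_le_gapDiv {a b s : ℝ} (ha : 0 ≤ a) (hb : 0 ≤ b) (hs : 0 ≤ s) :
    s * (b - a) - s ^ 2 / 2 * b ≤ gapDiv a b := by
  rcases hb.eq_or_lt with rfl | hb'
  · simp [gapDiv]; positivity
  · have hm : b - a ≤ max (b - a) 0 := le_max_left _ _
    have h1 : s * (b - a) ≤ s * max (b - a) 0 := mul_le_mul_of_nonneg_left hm hs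
    rw [gapDiv, le_div_iff₀ (by positivity)]
    nlinarith [sq_nonneg (max (b - a) 0 - s * b)]

/-- Since e^y ≥ 1 + y + y²/2, it suffices that (1 - y + y²/2)(1 + y + y²/2) = 1 + y⁴/4 ≥ 1. -/
lemma exp_neg_le_quadratic {y : ℝ} (hy : 0 ≤ y) : Real.exp (-y) ≤ 1 - y + y ^ 2 / 2 := by
  rw [Real.exp_neg, inv_le_iff_one_le_mul₀ (Real.exp_pos y)]
  have h := Real.quadratic_le_exp_of_nonneg hy
  have hq : 0 ≤ 1 - y + y ^ 2 / 2 := by nlinarith [sq_nonneg (y - 1)]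
  nlinarith [mul_le_mul_of_nonneg_left h hq, sq_nonneg (y ^ 2)]

/-- Solving `(b - a)² ≤ 2 b ε` for `b`. -/
lemma le_add_sqrt_add_of_linear_le {a b ε : ℝ} (ha : 0 ≤ a) (hε : 0 ≤ ε)
    (h : ∀ s, 0 ≤ s → s * (b - a) - s ^ 2 / 2 * b ≤ ε) : b ≤ a + √(2 * a * ε) + 2 * ε := by
  rcases le_or_gt b a with hba | hba
  · have := Real.sqrt_nonneg (2 * a * ε); linarith
  · have hb : 0 < b := ha.trans_lt hba
    -- The maximizing `s`.
    have hs := h ((b - a) / b) (div_nonneg (by linarith) hb.le)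
    have h2 : (b - a) / b * (b - a) - ((b - a) / b) ^ 2 / 2 * b = (b - a) ^ 2 / (2 * b) := by
      field_simp; ring
    rw [h2, div_le_iff₀ (by positivity)] at hs
    have hr := Real.sqrt_nonneg (2 * a * ε)
    have hrr : √(2 * a * ε) ^ 2 = 2 * a * ε := Real.sq_sqrt (by positivity)
    by_contra! hlt
    nlinarith

/-! ### Lower-tail Chernoff bounds and exponential moments of `gapDiv`. -/

section Chernoff

variable {Z : Type*} [MeasurableSpace Z] {P : Measure Z} [IsProbabilityMeasure P] {W : Z → ℝ}

/-- On [0,1] one has W² ≤ W, so the second-order term is controlled by the mean itself; this is the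
origin of the fast rate. -/
lemma integral_exp_neg_mul_le (hW : Measurable W) (h01 : ∀ z, W z ∈ Set.Icc (0 : ℝ) 1) {s : ℝ}
    (hs : 0 ≤ s) :
    ∫ z, Real.exp (-(s * W z)) ∂P ≤ Real.exp (-(s * ∫ z, W z ∂P) + s ^ 2 / 2 * ∫ z, W z ∂P) := by
  have hWint : Integrable W P := Integrable.of_bound hW.aestronglyMeasurable 1
    (.of_forall fun z => by rw [Real.norm_of_nonneg (h01 z).1]; exact (h01 z).2)
  have hexp : Integrable (fun z => Real.exp (-(s * W z))) P :=
    Integrable.of_bound (by fun_prop) 1 (.of_forall fun z => by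
      rw [Real.norm_of_nonneg (Real.exp_pos _).le]
      exact Real.exp_le_one_iff.2 (neg_nonpos.2 (mul_nonneg hs (h01 z).1)))
  calc ∫ z, Real.exp (-(s * W z)) ∂P ≤ ∫ z, (1 + (s ^ 2 / 2 - s) * W z) ∂P := by
        refine integral_mono hexp ((integrable_const _).add (hWint.const_mul _)) fun z => ?_
        have h := exp_neg_le_quadratic (mul_nonneg hs (h01 z).1)
        have h2 : (s * W z) ^ 2 ≤ s ^ 2 * W z := by
          rw [mul_pow]
          exact mul_le_mul_of_nonneg_left (by nlinarith [(h01 z).1, (h01 z).2]) (sq_nonneg s)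
        simp only
        linarith
    _ = 1 + (s ^ 2 / 2 - s) * ∫ z, W z ∂P := by
        rw [integral_add (integrable_const _) (hWint.const_mul _), integral_const_mul]; simp
    _ ≤ Real.exp ((s ^ 2 / 2 - s) * ∫ z, W z ∂P) := by
        rw [add_comm]; exact Real.add_one_le_exp _
    _ = _ := by congr 1; ring

/-- The empirical mean of `W` over a sample. -/
noncomputable def empMean {Z : Type*} {n : ℕ} (W : Z → ℝ) (S : Fin n → Z) : ℝ :=
  1 / n * ∑ i, W (S i)

lemma empMean_nonneg {Z : Type*} {W : Z → ℝ} {n : ℕ} (h01 : ∀ z, W z ∈ Set.Icc (0 : ℝ) 1)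
    (S : Fin n → Z) :
    0 ≤ empMean W S :=
  mul_nonneg (by positivity) (Finset.sum_nonneg fun i _ => (h01 _).1)

lemma empMean_le_one {Z : Type*} {W : Z → ℝ} {n : ℕ} (h01 : ∀ z, W z ∈ Set.Icc (0 : ℝ) 1)
    (S : Fin n → Z) :
    empMean W S ≤ 1 := by
  have h : ∑ i, W (S i) ≤ n := by
    refine (Finset.sum_le_card_nsmul _ _ 1 fun i _ => (h01 _).2).trans (by simp)
  rw [empMean, one_div_mul_eq_div]
  exact div_le_one_of_le₀ h (by positivity)

lemma integral_mem_Icc (hW : Measurable W) (h01 : ∀ z, W z ∈ Set.Icc (0 : ℝ) 1) :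
    ∫ z, W z ∂P ∈ Set.Icc (0 : ℝ) 1 := by
  refine ⟨integral_nonneg fun z => (h01 z).1, ?_⟩
  have := integral_mono (μ := P) (Integrable.of_bound hW.aestronglyMeasurable 1
    (.of_forall fun z => by rw [Real.norm_of_nonneg (h01 z).1]; exact (h01 z).2))
    (integrable_const (1 : ℝ)) fun z => (h01 z).2
  simpa using this

lemma measurable_empMean {n : ℕ} (hW : Measurable W) :
    Measurable fun S : Fin n → Z => empMean W S := by
  unfold empMean; fun_prop

lemma measurable_gapDiv_empMean {n : ℕ} (hW : Measurable W) (b : ℝ) :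
    Measurable fun S : Fin n → Z => gapDiv (empMean W S) b := by
  have := measurable_empMean (n := n) hW
  unfold gapDiv; fun_prop

/-- Chernoff's bound for the lower tail of a sum. -/
lemma measureReal_sum_le_le {n : ℕ} (hW : Measurable W) (h01 : ∀ z, W z ∈ Set.Icc (0 : ℝ) 1)
    {s : ℝ} (hs : 0 ≤ s) (u : ℝ) :
    (Measure.pi fun _ : Fin n => P).real {S | ∑ i, W (S i) ≤ u}
      ≤ Real.exp (s * u + n * (-(s * ∫ z, W z ∂P) + s ^ 2 / 2 * ∫ z, W z ∂P)) := by
  have hexp_meas : Measurable fun S : Fin n → Z => Real.exp (-(s * ∑ i, W (S i))) := by fun_prop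
  have hint : Integrable (fun S : Fin n → Z => Real.exp (-(s * ∑ i, W (S i))))
      (Measure.pi fun _ : Fin n => P) :=
    Integrable.of_bound hexp_meas.aestronglyMeasurable 1 (.of_forall fun S => by
      rw [Real.norm_of_nonneg (Real.exp_pos _).le]
      exact Real.exp_le_one_iff.2 (neg_nonpos.2
        (mul_nonneg hs (Finset.sum_nonneg fun i _ => (h01 _).1))))
  have hnonneg : 0 ≤ᵐ[Measure.pi fun _ : Fin n => P]
      fun S : Fin n → Z => Real.exp (-(s * ∑ i, W (S i))) :=
    .of_forall fun S => (Real.exp_pos _).le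
  have hmarkov := mul_meas_ge_le_integral_of_nonneg hnonneg hint (Real.exp (-(s * u)))
  have hmom : ∫ S : Fin n → Z, Real.exp (-(s * ∑ i, W (S i))) ∂(Measure.pi fun _ : Fin n => P)
      ≤ Real.exp (n * (-(s * ∫ z, W z ∂P) + s ^ 2 / 2 * ∫ z, W z ∂P)) := by
    have h1 : ∀ S : Fin n → Z, Real.exp (-(s * ∑ i, W (S i))) = ∏ i, Real.exp (-(s * W (S i))) :=
      fun S => by rw [← Real.exp_sum, Finset.mul_sum, Finset.sum_neg_distrib]
    simp_rw [h1]
    rw [integral_fintype_prod_eq_pow (fun z => Real.exp (-(s * W z))), Fintype.card_fin,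
      Real.exp_nat_mul]
    exact pow_le_pow_left₀ (integral_nonneg fun z => (Real.exp_pos _).le)
      (integral_exp_neg_mul_le hW h01 hs) n
  have hsub : (Measure.pi fun _ : Fin n => P).real {S | ∑ i, W (S i) ≤ u}
      ≤ (Measure.pi fun _ : Fin n => P).real
        {S | Real.exp (-(s * u)) ≤ Real.exp (-(s * ∑ i, W (S i)))} :=
    measureReal_mono fun S hS => by
      simp only [Set.mem_ofPred_eq] at hS ⊢
      exact Real.exp_le_exp.2 (neg_le_neg (mul_le_mul_of_nonneg_left hS hs))
  have h := (mul_le_mul_of_nonneg_left hsub (Real.exp_pos (-(s * u))).le).trans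
    (hmarkov.trans hmom)
  rw [Real.exp_neg, inv_mul_le_iff₀ (Real.exp_pos _), ← Real.exp_add] at h
  exact h

/-- Chernoff's lower tail bound, in terms of `gapDiv`. -/
lemma measure_gapDiv_empMean_ge_le {n : ℕ} (hn : 0 < n) (hW : Measurable W)
    (h01 : ∀ z, W z ∈ Set.Icc (0 : ℝ) 1) {x : ℝ} (hx : 0 < x) :
    (Measure.pi fun _ : Fin n => P) {S | x ≤ gapDiv (empMean W S) (∫ z, W z ∂P)}
      ≤ ENNReal.ofReal (Real.exp (-(n * x))) := by
  have hn' : (0 : ℝ) < n := Nat.cast_pos.2 hn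
  have hb0 : 0 ≤ ∫ z, W z ∂P := (integral_mem_Icc hW h01).1
  have htail := fun s (hs : 0 ≤ s) u => measureReal_sum_le_le (P := P) (n := n) hW h01 hs u
  generalize ∫ z, W z ∂P = b at hb0 htail ⊢
  -- At b = 0 division by zero makes `gapDiv` vanish, so the event is empty.
  rcases hb0.eq_or_lt with hb | hb
  · have : {S : Fin n → Z | x ≤ gapDiv (empMean W S) b} = ∅ := by
      ext S; simp [gapDiv, ← hb, hx]
    rw [this]; simp
  -- `t` is the deviation at which `gapDiv` equals `x`; the optimal Chernoff parameter is then t/b,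
  -- with exponent -nt²/(2b) = -nx.
  obtain ⟨t, ht, htt⟩ : ∃ t : ℝ, 0 ≤ t ∧ t ^ 2 = 2 * b * x :=
    ⟨√(2 * b * x), Real.sqrt_nonneg _, Real.sq_sqrt (by positivity)⟩
  have hsub : {S : Fin n → Z | x ≤ gapDiv (empMean W S) b}
      ⊆ {S | ∑ i, W (S i) ≤ n * (b - t)} := by
    intro S hS
    simp only [Set.mem_ofPred_eq, gapDiv] at hS ⊢
    rw [le_div_iff₀ (by positivity)] at hS
    have h1 : t ≤ max (b - empMean W S) 0 := by
      refine le_of_sq_le_sq ?_ (le_max_right _ _)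
      rw [htt]; linarith
    have h2 : t ≤ b - empMean W S := by
      rcases le_total (b - empMean W S) 0 with h | h
      · rw [max_eq_right h] at hS
        nlinarith [mul_pos hx hb]
      · rwa [max_eq_left h] at h1
    have h3 : ∑ i, W (S i) = n * empMean W S := by
      rw [empMean, ← mul_assoc, mul_one_div_cancel hn'.ne', one_mul]
    rw [h3]
    exact mul_le_mul_of_nonneg_left (by linarith) hn'.le
  rw [← ofReal_measureReal]
  refine ENNReal.ofReal_le_ofReal ((measureReal_mono hsub).trans
    ((htail (t / b) (by positivity) _).trans_eq ?_))
  congr 1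
  have : x = t ^ 2 / (2 * b) := by rw [htt]; field_simp
  rw [this]; field_simp; ring

/-- Layer-cake bound for exponential moments of variables with an exponential tail. -/
lemma lintegral_exp_le_of_tail {Ω : Type*} [MeasurableSpace Ω] {Q : Measure Ω}
    [IsProbabilityMeasure Q] {Y : Ω → ℝ} (hY : Measurable Y) (hY0 : ∀ ω, 0 ≤ Y ω) {k : ℝ}
    (hk : 0 ≤ k)
    (htail : ∀ x, 0 < x → Q {ω | x ≤ Y ω} ≤ ENNReal.ofReal (Real.exp (-((k + 1) * x)))) :
    ∫⁻ ω, ENNReal.ofReal (Real.exp (k * Y ω)) ∂Q ≤ ENNReal.ofReal (k + 1) := by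
  have hprim : ∀ y : ℝ, ∫ t in (0 : ℝ)..y, k * Real.exp (k * t) = Real.exp (k * y) - 1 := by
    intro y
    have hderiv : ∀ t ∈ Set.uIcc 0 y, HasDerivAt (fun t => Real.exp (k * t))
        (k * Real.exp (k * t)) t := fun t _ => by
      have := ((hasDerivAt_id t).const_mul k).exp
      simpa [mul_comm] using this
    rw [intervalIntegral.integral_eq_sub_of_hasDerivAt hderiv
      (Continuous.intervalIntegrable (by fun_prop) _ _)]
    simp
  have hlayer := lintegral_comp_eq_lintegral_meas_le_mul (f := Y)
    (g := fun t => k * Real.exp (k * t)) Q (.of_forall hY0) hY.aemeasurable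
    (fun t _ => Continuous.intervalIntegrable (by fun_prop) _ _)
    (.of_forall fun t => by positivity)
  simp only [hprim] at hlayer
  have hsplit : ∀ ω, ENNReal.ofReal (Real.exp (k * Y ω))
      = 1 + ENNReal.ofReal (Real.exp (k * Y ω) - 1) := fun ω => by
    have : 0 ≤ Real.exp (k * Y ω) - 1 :=
      sub_nonneg.2 (Real.one_le_exp (mul_nonneg hk (hY0 ω)))
    rw [← ENNReal.ofReal_one, ← ENNReal.ofReal_add zero_le_one this]
    congr 1; ring
  simp_rw [hsplit]
  rw [lintegral_add_left measurable_const, lintegral_one, measure_univ, hlayer]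
  -- The tail rate k + 1 exceeds the moment exponent k by one, so the layer-cake integrand is at
  -- most k·e^(-t), of total mass k.
  have hbound : ∫⁻ t in Set.Ioi (0 : ℝ), Q {ω | t ≤ Y ω} * ENNReal.ofReal (k * Real.exp (k * t))
      ≤ ∫⁻ t in Set.Ioi (0 : ℝ), ENNReal.ofReal (k * Real.exp (-t)) := by
    refine setLIntegral_mono (by fun_prop) fun t ht => ?_
    calc Q {ω | t ≤ Y ω} * ENNReal.ofReal (k * Real.exp (k * t))
        ≤ ENNReal.ofReal (Real.exp (-((k + 1) * t))) * ENNReal.ofReal (k * Real.exp (k * t)) := by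
          gcongr; exact htail t ht
      _ = ENNReal.ofReal (k * Real.exp (-t)) := by
          rw [← ENNReal.ofReal_mul (Real.exp_pos _).le, mul_left_comm, ← Real.exp_add]
          congr 3; ring
  have hexp : ∫⁻ t in Set.Ioi (0 : ℝ), ENNReal.ofReal (k * Real.exp (-t)) = ENNReal.ofReal k := by
    rw [← ofReal_integral_eq_lintegral_ofReal
      ((exp_neg_integrableOn_Ioi 0 one_pos).const_mul k |>.congr (
        .of_forall fun t => by simp)) (.of_forall fun t => by positivity), integral_const_mul,
      integral_exp_neg_Ioi_zero, mul_one]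
  rw [add_comm k, ENNReal.ofReal_add zero_le_one hk, ENNReal.ofReal_one]
  gcongr
  exact hbound.trans hexp.le

/-- Exponential moment of the divergence between empirical and true means. -/
lemma lintegral_exp_gapDiv_le {n : ℕ} (hn : 0 < n) (hW : Measurable W)
    (h01 : ∀ z, W z ∈ Set.Icc (0 : ℝ) 1) :
    ∫⁻ S, ENNReal.ofReal (Real.exp (((n : ℝ) - 1) * gapDiv (empMean W S) (∫ z, W z ∂P)))
      ∂(Measure.pi fun _ : Fin n => P) ≤ n := by
  have h1 : (1 : ℝ) ≤ n := Nat.one_le_cast.2 hn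
  -- The tail has rate n, so the exponent must be n - 1 and the moment is at most n; both constants
  -- survive into the final bound.
  have h := lintegral_exp_le_of_tail (Q := Measure.pi fun _ : Fin n => P)
    (measurable_gapDiv_empMean (n := n) hW (∫ z, W z ∂P))
    (fun S => gapDiv_nonneg (integral_mem_Icc hW h01).1) (k := (n : ℝ) - 1) (by linarith)
    (fun x hx => by
      rw [sub_add_cancel]; exact measure_gapDiv_empMean_ge_le hn hW h01 hx)
  simpa using h

end Chernoff

/-- Change of measure (Donsker–Varadhan). -/
lemma integral_le_of_lintegral_exp_le {Θ : Type*} [MeasurableSpace Θ] {P Q : Measure Θ}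
    [IsProbabilityMeasure Q] {ψ g : Θ → ℝ} (hψ : Measurable ψ)
    (hQ : Q = P.withDensity fun θ => ENNReal.ofReal (Real.exp (ψ θ)))
    (hψint : Integrable ψ Q) (hg : Measurable g) (hgint : Integrable g Q) {C : ℝ} (hC : 0 < C)
    (hexp : ∫⁻ θ, ENNReal.ofReal (Real.exp (g θ)) ∂P ≤ ENNReal.ofReal C) :
    ∫ θ, g θ ∂Q ≤ ∫ θ, ψ θ ∂Q + Real.log C := by
  set F : Θ → ℝ := fun θ => Real.exp (g θ - ψ θ - Real.log C) with hF_def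
  have hFmeas : Measurable F := by fun_prop
  have hlin : ∫⁻ θ, ENNReal.ofReal (F θ) ∂Q ≤ 1 := by
    rw [hQ, lintegral_withDensity_eq_lintegral_mul _ (by fun_prop) (by fun_prop)]
    have : ∀ θ, ((fun θ => ENNReal.ofReal (Real.exp (ψ θ))) * fun θ => ENNReal.ofReal (F θ)) θ
        = ENNReal.ofReal C⁻¹ * ENNReal.ofReal (Real.exp (g θ)) := fun θ => by
      simp only [Pi.mul_apply, hF_def]
      rw [← ENNReal.ofReal_mul (Real.exp_pos _).le, ← ENNReal.ofReal_mul (by positivity),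
        ← Real.exp_add]
      congr 1
      rw [show ψ θ + (g θ - ψ θ - Real.log C) = g θ + -Real.log C by ring, Real.exp_add,
        Real.exp_neg, Real.exp_log hC, mul_comm]
    simp_rw [this]
    rw [lintegral_const_mul _ (by fun_prop)]
    calc ENNReal.ofReal C⁻¹ * ∫⁻ θ, ENNReal.ofReal (Real.exp (g θ)) ∂P
        ≤ ENNReal.ofReal C⁻¹ * ENNReal.ofReal C := by gcongr
      _ = 1 := by
        rw [← ENNReal.ofReal_mul (by positivity), inv_mul_cancel₀ hC.ne', ENNReal.ofReal_one]
  have hFint : Integrable F Q := by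
    refine ⟨hFmeas.aestronglyMeasurable, ?_⟩
    rw [hasFiniteIntegral_iff_ofReal (.of_forall fun θ => (Real.exp_pos _).le)]
    exact hlin.trans_lt ENNReal.one_lt_top
  have hF1 : ∫ θ, F θ ∂Q ≤ 1 := by
    rw [integral_eq_lintegral_of_nonneg_ae (.of_forall fun θ => (Real.exp_pos _).le)
      hFmeas.aestronglyMeasurable]
    exact ENNReal.toReal_le_of_le_ofReal zero_le_one (by simpa using hlin)
  -- Integrating x + 1 ≤ e^x against Q replaces Jensen's inequality for the logarithm.
  have hmono : ∫ θ, (g θ - ψ θ - Real.log C + 1) ∂Q ≤ ∫ θ, F θ ∂Q :=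
    integral_mono (((hgint.sub hψint).sub (integrable_const _)).add (integrable_const _)) hFint
      fun θ => Real.add_one_le_exp _
  have hgψ : Integrable (fun θ => g θ - ψ θ) Q := hgint.sub hψint
  simp_rw [sub_add] at hmono
  rw [integral_sub hgψ (integrable_const _), integral_sub hgint hψint, integral_const] at hmono
  simp only [probReal_univ, one_smul] at hmono
  linarith

/-! ### Isotropic Gaussian measures -/

lemma posSemidef_smul_one {d : ℕ} {v : ℝ} (hv : 0 ≤ v) :
    (v • (1 : Matrix (Fin d) (Fin d) ℝ)).PosSemidef :=
  Matrix.PosSemidef.one.smul hv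

/-- Comparing characteristic functions reduces isotropic Gaussian computations to products of
one-dimensional ones. -/
lemma multivariateGaussian_smul_one_eq_map_pi {d : ℕ} (μ : Params d) {v : ℝ} (hv : 0 ≤ v) :
    multivariateGaussian μ (v • (1 : Matrix (Fin d) (Fin d) ℝ))
      = (Measure.pi fun i => gaussianReal (μ i) v.toNNReal).map (WithLp.toLp 2) := by
  apply Measure.ext_of_charFun (E := Params d)
  ext t
  simp_rw [charFun_multivariateGaussian (posSemidef_smul_one hv), charFun_pi,
    charFun_gaussianReal, ← Complex.exp_sum]
  congr 1
  rw [Finset.sum_sub_distrib, PiLp.inner_apply]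
  simp only [Real.coe_toNNReal v hv, Matrix.smul_mulVec, Matrix.one_mulVec, dotProduct,
    Pi.smul_apply, smul_eq_mul, RCLike.inner_apply, conj_trivial]
  push_cast
  rw [Finset.sum_mul, Finset.sum_div]
  congr 1
  · exact Finset.sum_congr rfl fun i _ => by ring
  · exact Finset.sum_congr rfl fun i _ => by ring

/-- The logarithm of the density of `N(m, v)` with respect to `N(m₀, v₀)`. -/
noncomputable def gaussianLogRatio (m v m₀ v₀ t : ℝ) : ℝ :=
  1 / 2 * Real.log (v₀ / v) - (t - m) ^ 2 / (2 * v) + (t - m₀) ^ 2 / (2 * v₀)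

lemma measurable_gaussianLogRatio (m v m₀ v₀ : ℝ) : Measurable (gaussianLogRatio m v m₀ v₀) := by
  unfold gaussianLogRatio; fun_prop

lemma gaussianReal_eq_withDensity {m v m₀ v₀ : ℝ} (hv : 0 < v) (hv₀ : 0 < v₀) :
    gaussianReal m v.toNNReal = (gaussianReal m₀ v₀.toNNReal).withDensity
      fun t => ENNReal.ofReal (Real.exp (gaussianLogRatio m v m₀ v₀ t)) := by
  rw [gaussianReal_of_var_ne_zero _ (Real.toNNReal_pos.2 hv).ne',
    gaussianReal_of_var_ne_zero _ (Real.toNNReal_pos.2 hv₀).ne',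
    ← withDensity_mul _ (measurable_gaussianPDF _ _)
      (measurable_gaussianLogRatio m v m₀ v₀).exp.ennreal_ofReal]
  congr 1
  ext t
  simp only [Pi.mul_apply, gaussianPDF]
  rw [← ENNReal.ofReal_mul (gaussianPDFReal_nonneg _ _ _)]
  congr 1
  simp only [gaussianPDFReal, Real.coe_toNNReal v hv.le, Real.coe_toNNReal v₀ hv₀.le,
    gaussianLogRatio]
  have hlog : Real.exp (1 / 2 * Real.log (v₀ / v)) = √v₀ / √v := by
    rw [← Real.sqrt_div hv₀.le, Real.sqrt_eq_rpow, Real.rpow_def_of_pos (by positivity), mul_comm]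
  rw [Real.exp_add, Real.exp_sub, hlog, neg_div, neg_div, Real.exp_neg, Real.exp_neg,
    Real.sqrt_mul (by positivity : 0 ≤ 2 * Real.pi) v,
    Real.sqrt_mul (by positivity : 0 ≤ 2 * Real.pi) v₀]
  field_simp

lemma integrable_sub_sq_gaussianReal (m c : ℝ) (v : ℝ≥0) :
    Integrable (fun t => (t - c) ^ 2) (gaussianReal m v) :=
  ((memLp_id_gaussianReal' 2 (by simp)).sub (memLp_const c)).integrable_sq

lemma integral_sub_sq_gaussianReal (m c : ℝ) (v : ℝ≥0) :
    ∫ t, (t - c) ^ 2 ∂(gaussianReal m v) = v + (m - c) ^ 2 := by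
  have hid : Integrable (fun t : ℝ => t) (gaussianReal m v) :=
    (memLp_id_gaussianReal' 1 (by simp)).integrable le_rfl
  have hvar : ∫ t, (t - m) ^ 2 ∂(gaussianReal m v) = v := by
    have h := variance_fun_id_gaussianReal (μ := m) (v := v)
    rwa [variance_eq_integral (by fun_prop), integral_id_gaussianReal] at h
  have hsplit : ∀ t : ℝ, (t - c) ^ 2 = (t - m) ^ 2 + (2 * (m - c) * t + ((m - c) ^ 2
      - 2 * (m - c) * m)) := fun t => by ring
  have hlin : Integrable (fun t => 2 * (m - c) * t + ((m - c) ^ 2 - 2 * (m - c) * m))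
      (gaussianReal m v) := (hid.const_mul _).add (integrable_const _)
  rw [integral_congr_ae (.of_forall hsplit),
    integral_add (integrable_sub_sq_gaussianReal m m v) hlin, integral_add (hid.const_mul _)
    (integrable_const _), hvar, integral_const_mul, integral_id_gaussianReal]
  simp

lemma integrable_gaussianLogRatio (m v m₀ v₀ : ℝ) (w : ℝ≥0) :
    Integrable (gaussianLogRatio m v m₀ v₀) (gaussianReal m w) :=
  ((integrable_const _).sub ((integrable_sub_sq_gaussianReal m m w).div_const _)).add
    ((integrable_sub_sq_gaussianReal m m₀ w).div_const _)

/-- The exact relative entropy also contains (v/v₀ - 1)/2, which v ≤ v₀ allows to be dropped. -/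
lemma integral_gaussianLogRatio_le {m v m₀ v₀ : ℝ} (hv : 0 < v) (hvv : v ≤ v₀) :
    ∫ t, gaussianLogRatio m v m₀ v₀ t ∂(gaussianReal m v.toNNReal)
      ≤ 1 / 2 * ((m - m₀) ^ 2 / v₀ + Real.log (v₀ / v)) := by
  have hv₀ : 0 < v₀ := hv.trans_le hvv
  unfold gaussianLogRatio
  have hsub : Integrable (fun t => 1 / 2 * Real.log (v₀ / v) - (t - m) ^ 2 / (2 * v))
      (gaussianReal m v.toNNReal) :=
    (integrable_const _).sub ((integrable_sub_sq_gaussianReal m m _).div_const _)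
  rw [integral_add hsub ((integrable_sub_sq_gaussianReal m m₀ _).div_const _),
    integral_sub (integrable_const _) ((integrable_sub_sq_gaussianReal m m _).div_const _),
    integral_div, integral_div, integral_sub_sq_gaussianReal, integral_sub_sq_gaussianReal,
    Real.coe_toNNReal v hv.le]
  simp only [integral_const, probReal_univ, one_smul, sub_self]
  have h1 : (v + 0 ^ 2) / (2 * v) = 1 / 2 := by field_simp; ring
  have h2 : (v + (m - m₀) ^ 2) / (2 * v₀) = 1 / 2 * (v / v₀) + 1 / 2 * ((m - m₀) ^ 2 / v₀) := by
    field_simp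
  have h3 : v / v₀ ≤ 1 := (div_le_one hv₀).2 hvv
  rw [h1, h2]
  linarith

/-- Products of measures with densities. -/
lemma pi_withDensity_eq {ι : Type*} [Fintype ι] {α : ι → Type*} [∀ i, MeasurableSpace (α i)]
    (P : ∀ i, Measure (α i)) [∀ i, IsProbabilityMeasure (P i)] {f : ∀ i, α i → ℝ≥0∞}
    (hf : ∀ i, Measurable (f i)) [∀ i, SigmaFinite ((P i).withDensity (f i))] :
    Measure.pi (fun i => (P i).withDensity (f i))
      = (Measure.pi P).withDensity fun x => ∏ i, f i (x i) := by
  refine Measure.pi_eq fun s hs => ?_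
  have hind : ∀ i, Measurable ((s i).indicator (f i)) := fun i => (hf i).indicator (hs i)
  rw [withDensity_apply _ (MeasurableSet.univ_pi hs),
    ← lintegral_indicator (MeasurableSet.univ_pi hs)]
  have hprod : ∀ x : ∀ i, α i, (Set.univ.pi s).indicator (fun x => ∏ i, f i (x i)) x
      = ∏ i, (s i).indicator (f i) (x i) := fun x => by
    classical
    by_cases hx : x ∈ Set.univ.pi s
    · rw [Set.indicator_of_mem hx]
      exact Finset.prod_congr rfl fun i _ => (Set.indicator_of_mem (hx i trivial) _).symm
    · rw [Set.indicator_of_notMem hx]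
      simp only [Set.mem_univ_pi, not_forall] at hx
      obtain ⟨i, hi⟩ := hx
      exact (Finset.prod_eq_zero (Finset.mem_univ i) (Set.indicator_of_notMem hi _)).symm
  simp_rw [hprod]
  rw [lintegral_prod_eq_prod_lintegral_of_indepFun Finset.univ
    (fun i (x : ∀ i, α i) => (s i).indicator (f i) (x i))
    (iIndepFun_pi fun i => (hind i).aemeasurable)
    (fun i => (hind i).comp (measurable_pi_apply i))]
  refine Finset.prod_congr rfl fun i _ => ?_
  rw [(measurePreserving_eval P i).lintegral_comp (hind i), lintegral_indicator (hs i),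
    withDensity_apply _ (hs i)]

/-- Density and relative entropy of isotropic Gaussian measures. -/
lemma exists_logDensity_multivariateGaussian {d : ℕ} (μ m₀ : Params d) {v v₀ : ℝ} (hv : 0 < v)
    (hvv : v ≤ v₀) :
    ∃ ψ : Params d → ℝ, Measurable ψ ∧
      multivariateGaussian μ (v • (1 : Matrix (Fin d) (Fin d) ℝ))
        = (multivariateGaussian m₀ (v₀ • (1 : Matrix (Fin d) (Fin d) ℝ))).withDensity
          (fun θ => ENNReal.ofReal (Real.exp (ψ θ))) ∧
      Integrable ψ (multivariateGaussian μ (v • (1 : Matrix (Fin d) (Fin d) ℝ))) ∧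
      ∫ θ, ψ θ ∂(multivariateGaussian μ (v • (1 : Matrix (Fin d) (Fin d) ℝ)))
        ≤ 1 / 2 * (‖μ - m₀‖ ^ 2 / v₀ + d * Real.log (v₀ / v)) := by
  have hv₀ : 0 < v₀ := hv.trans_le hvv
  have hr : ∀ i : Fin d, Measurable (gaussianLogRatio (μ i) v (m₀ i) v₀) := fun i =>
    measurable_gaussianLogRatio _ _ _ _
  have hψ : Measurable fun θ : Params d => ∑ i, gaussianLogRatio (μ i) v (m₀ i) v₀ (θ i) := by
    refine Finset.measurable_sum _ fun i _ => (hr i).comp (by fun_prop)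
  have htoLp : Measurable (WithLp.toLp 2 : (Fin d → ℝ) → Params d) := by fun_prop
  have hint : ∀ i, Integrable (fun x : Fin d → ℝ => gaussianLogRatio (μ i) v (m₀ i) v₀ (x i))
      (Measure.pi fun i => gaussianReal (μ i) v.toNNReal) := fun i =>
    (measurePreserving_eval (fun i => gaussianReal (μ i) v.toNNReal) i).integrable_comp_of_integrable
      (integrable_gaussianLogRatio _ _ _ _ _)
  refine ⟨_, hψ, ?_, ?_, ?_⟩
  · rw [multivariateGaussian_smul_one_eq_map_pi μ hv.le,
      multivariateGaussian_smul_one_eq_map_pi m₀ hv₀.le]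
    have hpi : (Measure.pi fun i => gaussianReal (μ i) v.toNNReal)
        = (Measure.pi fun i => gaussianReal (m₀ i) v₀.toNNReal).withDensity
          fun x => ∏ i, ENNReal.ofReal (Real.exp (gaussianLogRatio (μ i) v (m₀ i) v₀ (x i))) := by
      have heq := fun i => gaussianReal_eq_withDensity (m := μ i) (m₀ := m₀ i) hv hv₀
      have : ∀ i, SigmaFinite ((gaussianReal (m₀ i) v₀.toNNReal).withDensity
          fun t => ENNReal.ofReal (Real.exp (gaussianLogRatio (μ i) v (m₀ i) v₀ t))) := fun i => by
        rw [← heq i]; infer_instance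
      rw [← pi_withDensity_eq _ fun i => (hr i).exp.ennreal_ofReal]
      exact congrArg Measure.pi (funext heq)
    rw [hpi]
    ext s hs
    rw [Measure.map_apply htoLp hs, withDensity_apply _ (htoLp hs), withDensity_apply _ hs,
      setLIntegral_map hs hψ.exp.ennreal_ofReal htoLp]
    refine lintegral_congr fun x => ?_
    rw [Real.exp_sum, ENNReal.ofReal_prod_of_nonneg fun i _ => (Real.exp_pos _).le]
  · rw [multivariateGaussian_smul_one_eq_map_pi μ hv.le,
      integrable_map_measure hψ.aestronglyMeasurable htoLp.aemeasurable]
    exact integrable_finsetSum _ fun i _ => hint i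
  · rw [multivariateGaussian_smul_one_eq_map_pi μ hv.le,
      integral_map htoLp.aemeasurable hψ.aestronglyMeasurable]
    simp only
    rw [integral_finsetSum _ fun i _ => hint i]
    have hi : ∀ i, ∫ x : Fin d → ℝ, gaussianLogRatio (μ i) v (m₀ i) v₀ (x i)
        ∂(Measure.pi fun i => gaussianReal (μ i) v.toNNReal)
        ≤ 1 / 2 * ((μ i - m₀ i) ^ 2 / v₀ + Real.log (v₀ / v)) := fun i => by
      refine le_of_eq_of_le ?_ (integral_gaussianLogRatio_le hv hvv)
      have hm := measurePreserving_eval (fun i => gaussianReal (μ i) v.toNNReal) i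
      rw [← hm.map_eq, integral_map hm.measurable.aemeasurable (hr i).aestronglyMeasurable]
    refine (Finset.sum_le_sum fun i _ => hi i).trans_eq ?_
    rw [← Finset.mul_sum, Finset.sum_add_distrib, ← Finset.sum_div, EuclideanSpace.real_norm_sq_eq]
    simp

lemma integral_exp_inner_multivariateGaussian {d : ℕ} (μ u : Params d) {v : ℝ} (hv : 0 ≤ v) :
    ∫ θ, Real.exp (inner ℝ θ u) ∂(multivariateGaussian μ (v • (1 : Matrix (Fin d) (Fin d) ℝ)))
      = Real.exp (inner ℝ μ u + v * ‖u‖ ^ 2 / 2) := by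
  have htoLp : Measurable (WithLp.toLp 2 : (Fin d → ℝ) → Params d) := by fun_prop
  rw [multivariateGaussian_smul_one_eq_map_pi μ hv,
    integral_map htoLp.aemeasurable (by fun_prop)]
  have h1 : ∀ x : Fin d → ℝ, Real.exp (inner ℝ (WithLp.toLp 2 x : Params d) u)
      = ∏ i, Real.exp (u i * x i) := fun x => by
    rw [← Real.exp_sum, PiLp.inner_apply]; simp
  simp_rw [h1]
  rw [integral_fintype_prod_eq_prod (fun i t => Real.exp (u i * t))]
  have h2 : ∀ i, ∫ t, Real.exp (u i * t) ∂(gaussianReal (μ i) v.toNNReal)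
      = Real.exp (μ i * u i + v * u i ^ 2 / 2) := fun i => by
    have := congrFun (mgf_fun_id_gaussianReal (μ := μ i) (v := v.toNNReal)) (u i)
    rwa [mgf, Real.coe_toNNReal v hv] at this
  simp_rw [h2]
  rw [← Real.exp_sum, Finset.sum_add_distrib, EuclideanSpace.real_norm_sq_eq, PiLp.inner_apply,
    Finset.mul_sum, Finset.sum_div]
  simp [mul_comm]

/-- The Bochner integral of a non-integrable function is 0, whereas the computed value is positive.
-/
lemma integrable_exp_inner_multivariateGaussian {d : ℕ} (μ u : Params d) {v : ℝ} (hv : 0 ≤ v) :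
    Integrable (fun θ : Params d => Real.exp (inner ℝ θ u))
      (multivariateGaussian μ (v • (1 : Matrix (Fin d) (Fin d) ℝ))) := by
  by_contra h
  have h1 := integral_undef h
  rw [integral_exp_inner_multivariateGaussian μ u hv] at h1
  exact (Real.exp_pos _).ne' h1

/-! ### The Gumbel-max trick -/

lemma lintegral_Ioi_exp_neg_mul {C : ℝ} (hC : 0 < C) (c : ℝ) :
    ∫⁻ u in Set.Ioi c, ENNReal.ofReal (Real.exp (-(C * u)))
      = ENNReal.ofReal (Real.exp (-(C * c)) / C) := by
  have hint : IntegrableOn (fun u => Real.exp (-(C * u))) (Set.Ioi c) := by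
    simpa only [neg_mul] using exp_neg_integrableOn_Ioi c hC
  rw [← ofReal_integral_eq_lintegral_ofReal hint (.of_forall fun u => (Real.exp_pos _).le)]
  congr 1
  have h := integral_exp_mul_Ioi (neg_lt_zero.2 hC) c
  simp only [neg_mul] at h
  rw [h, neg_div_neg_eq]

/-- The substitution u = e^(-t) turns Gumbel-type densities into exponential ones of rate C. -/
lemma setLIntegral_gumbel_density (C : ℝ) {s : Set ℝ} (hs : MeasurableSet s) :
    ∫⁻ t in s, ENNReal.ofReal (Real.exp (-(t + C * Real.exp (-t))))
      = ∫⁻ u in (fun t => Real.exp (-t)) '' s, ENNReal.ofReal (Real.exp (-(C * u))) := by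
  have hderiv : ∀ t ∈ s, HasDerivWithinAt (fun t => Real.exp (-t)) (-Real.exp (-t)) s t :=
    fun t _ => by
      have := (hasDerivAt_neg t).exp
      simpa using this.hasDerivWithinAt
  have hinj : Set.InjOn (fun t : ℝ => Real.exp (-t)) s := fun x _ y _ h =>
    neg_injective (Real.exp_injective h)
  rw [lintegral_image_eq_lintegral_abs_deriv_mul hs hderiv hinj]
  refine lintegral_congr fun t => ?_
  rw [abs_neg, abs_of_pos (Real.exp_pos _), ← ENNReal.ofReal_mul (Real.exp_pos _).le,
    ← Real.exp_add, neg_add]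

lemma lintegral_gumbel_density {C : ℝ} (hC : 0 < C) :
    ∫⁻ t, ENNReal.ofReal (Real.exp (-(t + C * Real.exp (-t)))) = ENNReal.ofReal C⁻¹ := by
  have himage : (fun t : ℝ => Real.exp (-t)) '' Set.univ = Set.Ioi 0 := by
    ext u
    simp only [Set.image_univ, Set.mem_range, Set.mem_Ioi]
    refine ⟨?_, fun hu => ⟨-Real.log u, by rw [neg_neg, Real.exp_log hu]⟩⟩
    rintro ⟨t, rfl⟩
    exact Real.exp_pos _
  have h := setLIntegral_gumbel_density C MeasurableSet.univ
  rw [setLIntegral_univ, himage, lintegral_Ioi_exp_neg_mul hC] at h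
  simpa using h

lemma stdGumbel_Iio (c : ℝ) :
    stdGumbel (Set.Iio c) = ENNReal.ofReal (Real.exp (-Real.exp (-c))) := by
  have himage : (fun t : ℝ => Real.exp (-t)) '' Set.Iio c = Set.Ioi (Real.exp (-c)) := by
    ext u
    simp only [Set.mem_image, Set.mem_Iio, Set.mem_Ioi]
    constructor
    · rintro ⟨t, ht, rfl⟩
      exact Real.exp_lt_exp.2 (neg_lt_neg ht)
    · intro hu
      have hu0 : 0 < u := (Real.exp_pos _).trans hu
      refine ⟨-Real.log u, ?_, by rw [neg_neg, Real.exp_log hu0]⟩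
      have := (Real.lt_log_iff_exp_lt hu0).2 hu
      linarith
  have h := setLIntegral_gumbel_density 1 (measurableSet_Iio (a := c))
  rw [himage, lintegral_Ioi_exp_neg_mul one_pos] at h
  simp only [one_mul, div_one] at h
  rw [stdGumbel, withDensity_apply _ measurableSet_Iio, h]

instance isProbabilityMeasure_stdGumbel : IsProbabilityMeasure stdGumbel := by
  refine ⟨?_⟩
  have h := lintegral_gumbel_density one_pos
  simp only [one_mul, inv_one, ENNReal.ofReal_one] at h
  rw [stdGumbel, withDensity_apply _ MeasurableSet.univ, setLIntegral_univ, h]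

/-- Noise vectors for which `a` is the unique maximizer of the perturbed scores. -/
def strictArgmaxSet {A : Type*} (s : A → ℝ) (a : A) : Set (A → ℝ) :=
  {γ | ∀ a', a' ≠ a → s a' + γ a' < s a + γ a}

lemma measurableSet_strictArgmaxSet {A : Type*} [Countable A] (s : A → ℝ) (a : A) :
    MeasurableSet (strictArgmaxSet s a) := by
  have : strictArgmaxSet s a
      = ⋂ (a' : A) (_ : a' ≠ a), {γ : A → ℝ | s a' + γ a' < s a + γ a} := by
    ext γ; simp [strictArgmaxSet]
  rw [this]
  exact MeasurableSet.iInter fun a' => MeasurableSet.iInter fun _ =>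
    measurableSet_lt (by fun_prop) (by fun_prop)

/-- With independent standard Gumbel noise the argmax has the softmax distribution. -/
lemma pi_stdGumbel_strictArgmaxSet {A : Type*} [Fintype A] (s : A → ℝ) (a : A) :
    (Measure.pi fun _ : A => stdGumbel) (strictArgmaxSet s a)
      = ENNReal.ofReal (Real.exp (s a) / ∑ a', Real.exp (s a')) := by
  classical
  have hmeas := measurableSet_strictArgmaxSet s a
  have huniv : (Finset.univ : Finset A) = insert a (Finset.univ.erase a) :=
    (Finset.insert_erase (Finset.mem_univ a)).symm
  -- The noise of `a` is integrated last. Given its value t, the other coordinates must satisfy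
  -- independent upper bounds. The base point 0 is irrelevant because every coordinate is
  -- integrated.
  rw [← lintegral_indicator_one hmeas, lintegral_eq_lmarginal_univ (0 : A → ℝ)]
  conv_lhs => rw [huniv]
  rw [lmarginal_insert _ (measurable_one.indicator hmeas) (Finset.notMem_erase a _)]
  have hinner : ∀ t : ℝ, lmarginal (fun _ : A => stdGumbel) (Finset.univ.erase a)
      ((strictArgmaxSet s a).indicator 1) (Function.update (0 : A → ℝ) a t)
      = ENNReal.ofReal (∏ i ∈ Finset.univ.erase a, Real.exp (-Real.exp (-(s a + t - s i)))) := by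
    intro t
    rw [lmarginal]
    have hset : ∀ y : (Finset.univ.erase a) → ℝ, (strictArgmaxSet s a).indicator (1 : (A → ℝ) → ℝ≥0∞)
        (Function.updateFinset (Function.update (0 : A → ℝ) a t) (Finset.univ.erase a) y)
        = (Set.univ.pi fun i : (Finset.univ.erase a) => Set.Iio (s a + t - s i)).indicator 1 y := by
      intro y
      refine Set.indicator_eq_indicator ?_ rfl
      have ha : Function.updateFinset (Function.update (0 : A → ℝ) a t) (Finset.univ.erase a) y a
          = t := by simp [Function.updateFinset]
      simp only [strictArgmaxSet, Set.mem_ofPred_eq, Set.mem_univ_pi, Set.mem_Iio, ha]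
      constructor
      · intro h i
        have hi := Finset.ne_of_mem_erase i.2
        have := h i hi
        simp only [Function.updateFinset, i.2, dif_pos] at this
        linarith
      · intro h a' ha'
        have hmem : a' ∈ Finset.univ.erase a := Finset.mem_erase.2 ⟨ha', Finset.mem_univ _⟩
        have := h ⟨a', hmem⟩
        simp only [Function.updateFinset, hmem, dif_pos]
        linarith
    simp_rw [hset]
    rw [lintegral_indicator_one (MeasurableSet.univ_pi fun i => measurableSet_Iio),
      Measure.pi_pi]
    simp_rw [stdGumbel_Iio]
    rw [Finset.prod_coe_sort (Finset.univ.erase a)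
      (fun i => ENNReal.ofReal (Real.exp (-Real.exp (-(s a + t - s i))))),
      ENNReal.ofReal_prod_of_nonneg fun i _ => (Real.exp_pos _).le]
  simp_rw [hinner]
  -- `C` collects all double exponentials; its i = a term is the one in the density of the noise of
  -- `a`. The remaining integral is 1/C, the softmax value.
  set C := ∑ i, Real.exp (s i - s a) with hC_def
  have hC : 0 < C := Finset.sum_pos (fun i _ => Real.exp_pos _) ⟨a, Finset.mem_univ a⟩
  rw [stdGumbel, lintegral_withDensity_eq_lintegral_mul _ (by fun_prop) (by fun_prop)]
  have hdens : ∀ t : ℝ, ((fun t => ENNReal.ofReal (Real.exp (-(t + Real.exp (-t))))) * fun t =>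
      ENNReal.ofReal (∏ i ∈ Finset.univ.erase a, Real.exp (-Real.exp (-(s a + t - s i))))) t
      = ENNReal.ofReal (Real.exp (-(t + C * Real.exp (-t)))) := by
    intro t
    simp only [Pi.mul_apply]
    rw [← ENNReal.ofReal_mul (Real.exp_pos _).le, ← Real.exp_sum, ← Real.exp_add]
    congr 2
    have hsplit : C * Real.exp (-t)
        = Real.exp (-t) + ∑ i ∈ Finset.univ.erase a, Real.exp (-(s a + t - s i)) := by
      rw [hC_def, ← Finset.add_sum_erase _ _ (Finset.mem_univ a), add_mul, sub_self, Real.exp_zero,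
        one_mul, Finset.sum_mul]
      congr 1
      refine Finset.sum_congr rfl fun i _ => ?_
      rw [← Real.exp_add]; congr 1; ring
    rw [hsplit, Finset.sum_neg_distrib]
    ring
  simp_rw [hdens]
  rw [lintegral_gumbel_density hC]
  congr 1
  simp_rw [hC_def, Real.exp_sub]
  rw [← Finset.sum_div, inv_div]

/-! ### Softmax policies and the law of the perturbed argmax. -/

section Policy

variable {X A : Type*} [Fintype A] {d : ℕ} (φ : X → A → Params d)

lemma softmaxProb_nonneg (θ : Params d) (x : X) (a : A) : 0 ≤ softmaxProb φ θ x a := by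
  unfold softmaxProb; positivity

lemma sum_exp_pos [Nonempty A] (θ : Params d) (x : X) :
    0 < ∑ a' : A, Real.exp (inner ℝ θ (φ x a')) :=
  Finset.sum_pos (fun _ _ => Real.exp_pos _) Finset.univ_nonempty

lemma sum_softmaxProb [Nonempty A] (θ : Params d) (x : X) : ∑ a, softmaxProb φ θ x a = 1 := by
  unfold softmaxProb
  rw [← Finset.sum_div, div_self (sum_exp_pos φ θ x).ne']

lemma softmaxProb_le_one [Nonempty A] (θ : Params d) (x : X) (a : A) :
    softmaxProb φ θ x a ≤ 1 := by
  rw [← sum_softmaxProb φ θ x]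
  exact Finset.single_le_sum (fun i _ => softmaxProb_nonneg φ θ x i) (Finset.mem_univ a)

lemma continuous_softmaxProb [Nonempty A] (x : X) (a : A) :
    Continuous fun θ => softmaxProb φ θ x a := by
  unfold softmaxProb
  exact Continuous.div (by fun_prop) (by fun_prop) fun θ => (sum_exp_pos φ θ x).ne'

lemma hypothesis_eq_of_mem_strictArgmaxSet [Nonempty A] {w : Params d × (A → ℝ)} {x : X} {a : A}
    (h : w.2 ∈ strictArgmaxSet (fun a => inner ℝ w.1 (φ x a)) a) : hypothesis φ w x = a := by
  by_contra hne
  have hmax := (Finite.exists_max fun a : A => inner ℝ w.1 (φ x a) + w.2 a).choose_spec a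
  exact absurd (h _ hne) (not_lt.2 hmax)

instance isProbabilityMeasure_mixedLogitPosterior (μ : Params d) (v : ℝ) :
    IsProbabilityMeasure (mixedLogitPosterior A μ v) := by
  unfold mixedLogitPosterior; infer_instance

lemma measurableSet_posterior_strictArgmaxSet (x : X) (a : A) :
    MeasurableSet {w : Params d × (A → ℝ) |
      w.2 ∈ strictArgmaxSet (fun a => inner ℝ w.1 (φ x a)) a} := by
  have : {w : Params d × (A → ℝ) | w.2 ∈ strictArgmaxSet (fun a => inner ℝ w.1 (φ x a)) a}
      = ⋂ (a' : A) (_ : a' ≠ a), {w : Params d × (A → ℝ) |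
        inner ℝ w.1 (φ x a') + w.2 a' < inner ℝ w.1 (φ x a) + w.2 a} := by
    ext w; simp [strictArgmaxSet]
  rw [this]
  exact MeasurableSet.iInter fun a' => MeasurableSet.iInter fun _ =>
    measurableSet_lt (by fun_prop) (by fun_prop)

lemma mixedLogitPosterior_strictArgmaxSet (μ : Params d) (v : ℝ) (x : X) (a : A) :
    mixedLogitPosterior A μ v {w | w.2 ∈ strictArgmaxSet (fun a => inner ℝ w.1 (φ x a)) a}
      = ∫⁻ θ, ENNReal.ofReal (softmaxProb φ θ x a)
          ∂(multivariateGaussian μ (v • (1 : Matrix (Fin d) (Fin d) ℝ))) := by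
  rw [mixedLogitPosterior, Measure.prod_apply (measurableSet_posterior_strictArgmaxSet φ x a)]
  refine lintegral_congr fun θ => ?_
  exact pi_stdGumbel_strictArgmaxSet (fun a => inner ℝ θ (φ x a)) a

variable [Nonempty A]

/-- Ties in the perturbed scores have probability zero. -/
lemma ae_mem_strictArgmaxSet_hypothesis (μ : Params d) (v : ℝ) (x : X) :
    ∀ᵐ w ∂(mixedLogitPosterior A μ v),
      w.2 ∈ strictArgmaxSet (fun a => inner ℝ w.1 (φ x a)) (hypothesis φ w x) := by
  have hmeas := measurableSet_posterior_strictArgmaxSet φ x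
  set T : A → Set (Params d × (A → ℝ)) := fun a =>
    {w | w.2 ∈ strictArgmaxSet (fun a => inner ℝ w.1 (φ x a)) a} with hT
  have hdisj : Pairwise (Function.onFun Disjoint T) := fun a b hab =>
    Set.disjoint_left.2 fun w ha hb => hab <| by
      rw [← hypothesis_eq_of_mem_strictArgmaxSet φ ha, ← hypothesis_eq_of_mem_strictArgmaxSet φ hb]
  -- The strict-argmax events are disjoint and their softmax probabilities sum to 1, so nothing is
  -- left for ties.
  have hfull : mixedLogitPosterior A μ v (⋃ a, T a) = 1 := by
    rw [measure_iUnion hdisj hmeas, tsum_fintype]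
    simp_rw [hT, mixedLogitPosterior_strictArgmaxSet]
    rw [← lintegral_finsetSum _ fun a _ =>
      (continuous_softmaxProb φ x a).measurable.ennreal_ofReal]
    simp_rw [← ENNReal.ofReal_sum_of_nonneg fun a _ => softmaxProb_nonneg φ _ x a,
      sum_softmaxProb]
    simp
  have hae : ∀ᵐ w ∂(mixedLogitPosterior A μ v), w ∈ ⋃ a, T a := by
    exact (mem_ae_iff_prob_eq_one (MeasurableSet.iUnion hmeas)).2 hfull
  filter_upwards [hae] with w hw
  obtain ⟨a, ha⟩ := Set.mem_iUnion.1 hw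
  rw [hypothesis_eq_of_mem_strictArgmaxSet φ ha]
  exact ha

variable [MeasurableSpace A] [DiscreteMeasurableSpace A]

/-- Arbitrary tie-breaking gives no measurability directly, but ties are null, and elsewhere
preimages are unions of strict-argmax events. Without this, `Measure.map` in `mixedLogitPolicy`
would be the zero measure. -/
lemma aemeasurable_hypothesis (μ : Params d) (v : ℝ) (x : X) :
    AEMeasurable (fun w => hypothesis φ w x) (mixedLogitPosterior A μ v) := by
  refine NullMeasurable.aemeasurable fun s _ => ?_
  have hmeas : MeasurableSet (⋃ a ∈ s, {w : Params d × (A → ℝ) |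
      w.2 ∈ strictArgmaxSet (fun a => inner ℝ w.1 (φ x a)) a}) :=
    MeasurableSet.biUnion (Set.to_countable s) fun a _ =>
      measurableSet_posterior_strictArgmaxSet φ x a
  refine hmeas.nullMeasurableSet.congr ?_
  filter_upwards [ae_mem_strictArgmaxSet_hypothesis φ μ v x] with w hw
  refine propext ?_
  change w ∈ (⋃ a ∈ s, _) ↔ hypothesis φ w x ∈ s
  rw [Set.mem_iUnion₂]
  constructor
  · rintro ⟨a, has, ha⟩
    rwa [hypothesis_eq_of_mem_strictArgmaxSet φ ha]
  · exact fun h => ⟨_, h, hw⟩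

lemma isProbabilityMeasure_mixedLogitPolicy (μ : Params d) (v : ℝ) (x : X) :
    IsProbabilityMeasure (mixedLogitPolicy φ μ v x) :=
  Measure.isProbabilityMeasure_map (aemeasurable_hypothesis φ μ v x)

/-- The mixed logit policy is the Gaussian mixture of softmax policies. -/
lemma mixedLogitPolicy_real_singleton (μ : Params d) (v : ℝ) (x : X) (a : A) :
    (mixedLogitPolicy φ μ v x).real {a} = ∫ θ, softmaxProb φ θ x a
      ∂(multivariateGaussian μ (v • (1 : Matrix (Fin d) (Fin d) ℝ))) := by
  have h : mixedLogitPolicy φ μ v x {a} = ∫⁻ θ, ENNReal.ofReal (softmaxProb φ θ x a)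
      ∂(multivariateGaussian μ (v • (1 : Matrix (Fin d) (Fin d) ℝ))) := by
    rw [mixedLogitPolicy, Measure.map_apply_of_aemeasurable (aemeasurable_hypothesis φ μ v x)
      (measurableSet_singleton a), ← mixedLogitPosterior_strictArgmaxSet]
    refine measure_congr ?_
    filter_upwards [ae_mem_strictArgmaxSet_hypothesis φ μ v x] with w hw
    refine propext ?_
    change hypothesis φ w x = a ↔ w.2 ∈ strictArgmaxSet (fun a => inner ℝ w.1 (φ x a)) a
    refine ⟨fun ha => by rwa [ha] at hw, hypothesis_eq_of_mem_strictArgmaxSet φ⟩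
  rw [Measure.real, h, ← integral_eq_lintegral_of_nonneg_ae
    (.of_forall fun θ => softmaxProb_nonneg φ θ x a)
    (continuous_softmaxProb φ x a).aestronglyMeasurable]

end Policy

/-! ### Comparison of the Gaussian mixture with the softmax at its mean. -/

lemma integrable_softmaxProb {X A : Type*} [Fintype A] [Nonempty A] {d : ℕ}
    (φ : X → A → Params d) (Q : Measure (Params d)) [IsFiniteMeasure Q] (x : X) (a : A) :
    Integrable (fun θ => softmaxProb φ θ x a) Q :=
  Integrable.of_bound (continuous_softmaxProb φ x a).aestronglyMeasurable 1
    (.of_forall fun θ => by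
      rw [Real.norm_of_nonneg (softmaxProb_nonneg φ θ x a)]; exact softmaxProb_le_one φ θ x a)

/-- The Gaussian mixture of softmax policies dominates the softmax policy at the mean. -/
lemma exp_mul_softmaxProb_le_integral {X A : Type*} [Fintype A] [Nonempty A] {d : ℕ}
    (φ : X → A → Params d) {B : ℝ} (hφ : ∀ x a, ‖φ x a‖ ≤ B) (μ : Params d) {v : ℝ} (hv : 0 ≤ v)
    (x : X) (a : A) :
    Real.exp (-(1 / 2) * v * B ^ 2) * softmaxProb φ μ x a
      ≤ ∫ θ, softmaxProb φ θ x a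
        ∂(multivariateGaussian μ (v • (1 : Matrix (Fin d) (Fin d) ℝ))) := by
  set Q := multivariateGaussian μ (v • (1 : Matrix (Fin d) (Fin d) ℝ))
  set Z : Params d → ℝ := fun θ => ∑ a' : A, Real.exp (inner ℝ θ (φ x a')) with hZ_def
  have hZpos : ∀ θ, 0 < Z θ := fun θ => sum_exp_pos φ θ x
  set c := 1 / 2 * v * B ^ 2 with hc_def
  -- `K` bounds the Gaussian mean of the partition function `Z`, by the moment generating function
  -- and ‖φ‖ ≤ B.
  set K := Real.exp c * Z μ with hK_def
  have hK : 0 < K := mul_pos (Real.exp_pos _) (hZpos μ)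
  have hlow : Real.exp (-(1 / 2) * v * B ^ 2) * softmaxProb φ μ x a
      = Real.exp (inner ℝ μ (φ x a)) / K := by
    rw [show -(1 / 2) * v * B ^ 2 = -c by rw [hc_def]; ring, Real.exp_neg, softmaxProb]
    change (Real.exp c)⁻¹ * (Real.exp (inner ℝ μ (φ x a)) / Z μ) = _
    rw [hK_def]; field_simp
  have hZint : Integrable Z Q :=
    integrable_finsetSum _ fun a' _ => integrable_exp_inner_multivariateGaussian μ _ hv
  have hZmean : ∫ θ, Z θ ∂Q ≤ K := by
    rw [hZ_def, integral_finsetSum _ fun a' _ =>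
      integrable_exp_inner_multivariateGaussian μ _ hv, hK_def, hZ_def]
    simp only
    rw [Finset.mul_sum]
    refine Finset.sum_le_sum fun a' _ => ?_
    rw [integral_exp_inner_multivariateGaussian μ _ hv, ← Real.exp_add, add_comm]
    have h1 := pow_le_pow_left₀ (norm_nonneg _) (hφ x a') 2
    have h2 := mul_le_mul_of_nonneg_left h1 hv
    refine Real.exp_le_exp.2 (add_le_add ?_ le_rfl)
    rw [hc_def]; linarith
  have hidint : Integrable (fun θ : Params d => θ) Q := IsGaussian.integrable_fun_id
  have hlin_int : Integrable (fun θ : Params d => inner ℝ (φ x a) θ) Q := hidint.const_inner _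
  have hlin : ∫ θ, inner ℝ (φ x a) θ ∂Q = inner ℝ (φ x a) μ := by
    rw [integral_inner hidint, integral_id_multivariateGaussian]
  set e := Real.exp (inner ℝ μ (φ x a)) / K with he_def
  have he : 0 < e := div_pos (Real.exp_pos _) hK
  -- Tangent-line form of Jensen: e^x ≥ x + 1 for the exponential and log z ≤ z - 1 for the
  -- log-partition function. The minorant has mean at least `e`.
  have hpt : ∀ θ, e * (inner ℝ (φ x a) θ - Z θ / K + (2 - inner ℝ (φ x a) μ))
      ≤ softmaxProb φ θ x a := by
    intro θ
    have hlogZ : Real.log (Z θ / K) ≤ Z θ / K - 1 :=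
      Real.log_le_sub_one_of_pos (div_pos (hZpos θ) hK)
    have hsoft : softmaxProb φ θ x a
        = e * Real.exp (inner ℝ θ (φ x a) - inner ℝ μ (φ x a) - Real.log (Z θ / K)) := by
      have := hZpos θ
      rw [Real.exp_sub, Real.exp_sub, Real.exp_log (div_pos (hZpos θ) hK), he_def, softmaxProb]
      change Real.exp (inner ℝ θ (φ x a)) / Z θ = _
      field_simp
    rw [hsoft]
    refine mul_le_mul_of_nonneg_left (le_trans ?_ (Real.add_one_le_exp _)) he.le
    rw [real_inner_comm θ, real_inner_comm μ]
    linarith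
  have hint1 : Integrable (fun θ => inner ℝ (φ x a) θ - Z θ / K) Q :=
    hlin_int.sub (hZint.div_const K)
  have hmono := integral_mono ((hint1.add (integrable_const (2 - inner ℝ (φ x a) μ))).const_mul e)
    (integrable_softmaxProb φ Q x a) hpt
  simp only [Pi.add_apply] at hmono
  rw [integral_const_mul, integral_add hint1 (integrable_const _),
    integral_sub hlin_int (hZint.div_const K), hlin, integral_div, integral_const,
    probReal_univ, one_smul] at hmono
  rw [hlow]
  refine le_trans ?_ hmono
  have hdiv : (∫ θ, Z θ ∂Q) / K ≤ 1 := (div_le_one hK).2 hZmean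
  exact le_mul_of_one_le_right he.le (by linarith)

/-! ### The PAC-Bayes event -/

/-- PAC-Bayes bound for `[0,1]`-valued losses, simultaneous over all posteriors that have a log
density with respect to the prior. -/
theorem exists_pacBayes_event {Θ Z : Type*} [MeasurableSpace Θ] [MeasurableSpace Z]
    (P : Measure Z) [IsProbabilityMeasure P] (prior : Measure Θ) [IsProbabilityMeasure prior]
    {W : Θ → Z → ℝ} (hW : Measurable (Function.uncurry W))
    (h01 : ∀ θ z, W θ z ∈ Set.Icc (0 : ℝ) 1) {n : ℕ} (hn : 2 ≤ n) {δ : ℝ} (hδ : 0 < δ) :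
    ∃ E : Set (Fin n → Z), MeasurableSet E ∧ (Measure.pi fun _ : Fin n => P).real Eᶜ ≤ δ ∧
      ∀ S ∈ E, ∀ (Q : Measure Θ) [IsProbabilityMeasure Q] (ψ : Θ → ℝ), Measurable ψ →
        Q = prior.withDensity (fun θ => ENNReal.ofReal (Real.exp (ψ θ))) → Integrable ψ Q →
        ∀ K, ∫ θ, ψ θ ∂Q ≤ K →
          0 ≤ K + Real.log (n / δ) ∧
          ∫ θ, ∫ z, W θ z ∂P ∂Q ≤ ∫ θ, empMean (W θ) S ∂Q
            + √(2 * (∫ θ, empMean (W θ) S ∂Q) * ((K + Real.log (n / δ)) / ((n : ℝ) - 1)))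
            + 2 * ((K + Real.log (n / δ)) / ((n : ℝ) - 1)) := by
  have hn0 : 0 < n := by omega
  have hn1 : (0 : ℝ) < (n : ℝ) - 1 := by
    have : (2 : ℝ) ≤ n := by exact_mod_cast hn
    linarith
  have hn' : (0 : ℝ) < n := Nat.cast_pos.2 hn0
  have hWθ : ∀ θ, Measurable (W θ) := fun θ => hW.comp (measurable_const.prodMk measurable_id)
  have hb_meas : Measurable fun θ => ∫ z, W θ z ∂P :=
    hW.stronglyMeasurable.integral_prod_right.measurable
  have hemp_meas : Measurable fun p : Θ × (Fin n → Z) => empMean (W p.1) p.2 := by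
    have : ∀ i : Fin n, Measurable fun p : Θ × (Fin n → Z) => W p.1 (p.2 i) := fun i =>
      hW.comp (by fun_prop : Measurable fun p : Θ × (Fin n → Z) => (p.1, p.2 i))
    unfold empMean; fun_prop
  set g : Θ → (Fin n → Z) → ℝ := fun θ S =>
    ((n : ℝ) - 1) * gapDiv (empMean (W θ) S) (∫ z, W θ z ∂P) with hg_def
  have hg_meas : Measurable (Function.uncurry g) := by
    have h2 : Measurable fun p : Θ × (Fin n → Z) => ∫ z, W p.1 z ∂P := hb_meas.comp measurable_fst
    have : Function.uncurry g = fun p : Θ × (Fin n → Z) =>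
        ((n : ℝ) - 1) * gapDiv (empMean (W p.1) p.2) (∫ z, W p.1 z ∂P) := rfl
    rw [this]
    unfold gapDiv
    fun_prop
  -- Only the prior enters `Φ`, so a single use of Markov's inequality covers all posteriors.
  set Φ : (Fin n → Z) → ℝ≥0∞ := fun S =>
    ∫⁻ θ, ENNReal.ofReal (Real.exp (g θ S)) ∂prior with hΦ_def
  have hgexp : Measurable (Function.uncurry fun θ S => ENNReal.ofReal (Real.exp (g θ S))) :=
    hg_meas.exp.ennreal_ofReal
  have hΦ_meas : Measurable Φ := hgexp.lintegral_prod_left'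
  have hΦ_mean : ∫⁻ S, Φ S ∂(Measure.pi fun _ : Fin n => P) ≤ n := by
    have hswap : AEMeasurable (Function.uncurry fun (S : Fin n → Z) θ =>
        ENNReal.ofReal (Real.exp (g θ S))) ((Measure.pi fun _ : Fin n => P).prod prior) :=
      (hgexp.comp measurable_swap).aemeasurable
    rw [hΦ_def, lintegral_lintegral_swap hswap]
    calc _ ≤ ∫⁻ _, (n : ℝ≥0∞) ∂prior :=
          lintegral_mono fun θ => lintegral_exp_gapDiv_le hn0 (hWθ θ) (h01 θ)
      _ = n := by simp
  refine ⟨{S | Φ S ≤ ENNReal.ofReal (n / δ)}, measurableSet_le hΦ_meas measurable_const, ?_, ?_⟩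
  · have hsub : {S | Φ S ≤ ENNReal.ofReal (n / δ)}ᶜ ⊆ {S | ENNReal.ofReal (n / δ) ≤ Φ S} :=
      fun S hS => by
        simp only [Set.mem_compl_iff, Set.mem_ofPred_eq, not_le] at hS ⊢
        exact hS.le
    have hmarkov := (mul_meas_ge_le_lintegral (μ := Measure.pi fun _ : Fin n => P) hΦ_meas
      (ENNReal.ofReal (n / δ))).trans hΦ_mean
    have hle : (Measure.pi fun _ : Fin n => P) {S | ENNReal.ofReal (n / δ) ≤ Φ S}
        ≤ ENNReal.ofReal δ := by
      have hpos : ENNReal.ofReal (n / δ) ≠ 0 := by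
        rw [Ne, ENNReal.ofReal_eq_zero, not_le]; positivity
      rw [← ENNReal.mul_le_mul_iff_right hpos ENNReal.ofReal_ne_top,
        ← ENNReal.ofReal_mul (by positivity), div_mul_cancel₀ _ hδ.ne', ENNReal.ofReal_natCast]
      exact hmarkov
    exact ENNReal.toReal_le_of_le_ofReal hδ.le ((measure_mono hsub).trans hle)
  · intro S hS Q _ ψ hψ hQ hψint K hK
    have hb01 : ∀ θ, ∫ z, W θ z ∂P ∈ Set.Icc (0 : ℝ) 1 := fun θ => integral_mem_Icc (hWθ θ) (h01 θ)
    have ha0 : ∀ θ, 0 ≤ empMean (W θ) S := fun θ => empMean_nonneg (h01 θ) S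
    have hgS_meas : Measurable fun θ => g θ S :=
      hg_meas.comp (measurable_id.prodMk measurable_const)
    have ha_meas : Measurable fun θ => empMean (W θ) S :=
      hemp_meas.comp (measurable_id.prodMk measurable_const)
    have hg0 : ∀ θ, 0 ≤ g θ S := fun θ => mul_nonneg hn1.le (gapDiv_nonneg (hb01 θ).1)
    have hgint : Integrable (fun θ => g θ S) Q :=
      Integrable.of_bound hgS_meas.aestronglyMeasurable ((n : ℝ) - 1) (.of_forall fun θ => by
        rw [Real.norm_of_nonneg (hg0 θ)]
        exact mul_le_of_le_one_right hn1.le (gapDiv_le_one (ha0 θ) (hb01 θ)))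
    have haint : Integrable (fun θ => empMean (W θ) S) Q :=
      Integrable.of_bound ha_meas.aestronglyMeasurable 1 (.of_forall fun θ => by
        rw [Real.norm_of_nonneg (ha0 θ)]; exact empMean_le_one (h01 θ) S)
    have hbint : Integrable (fun θ => ∫ z, W θ z ∂P) Q :=
      Integrable.of_bound hb_meas.aestronglyMeasurable 1 (.of_forall fun θ => by
        rw [Real.norm_of_nonneg (hb01 θ).1]; exact (hb01 θ).2)
    have hdv := integral_le_of_lintegral_exp_le hψ hQ hψint hgS_meas hgint
      (by positivity : (0 : ℝ) < n / δ) hS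
    have hgK : ∫ θ, g θ S ∂Q ≤ K + Real.log (n / δ) := by linarith
    -- This quantity dominates the mean of the nonnegative `g`; its sign is needed for the square
    -- root here and in the final rescaling.
    have hnn : 0 ≤ K + Real.log (n / δ) := (integral_nonneg hg0).trans hgK
    refine ⟨hnn, le_add_sqrt_add_of_linear_le (integral_nonneg ha0) (div_nonneg hnn hn1.le) ?_⟩
    intro s hs
    have hsub : Integrable (fun θ => s * (∫ z, W θ z ∂P - empMean (W θ) S)) Q :=
      (hbint.sub haint).const_mul s
    have hlin : ∫ θ, (s * (∫ z, W θ z ∂P - empMean (W θ) S) - s ^ 2 / 2 * ∫ z, W θ z ∂P) ∂Q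
        = s * (∫ θ, ∫ z, W θ z ∂P ∂Q - ∫ θ, empMean (W θ) S ∂Q)
          - s ^ 2 / 2 * ∫ θ, ∫ z, W θ z ∂P ∂Q := by
      rw [integral_sub hsub (hbint.const_mul _), integral_const_mul, integral_const_mul,
        integral_sub hbint haint]
    rw [← hlin, le_div_iff₀ hn1, ← integral_mul_const]
    refine le_trans (integral_mono ((hsub.sub (hbint.const_mul _)).mul_const _) hgint fun θ => ?_)
      hgK
    simp only [hg_def]
    rw [mul_comm]
    exact mul_le_mul_of_nonneg_left (linear_le_gapDiv (ha0 θ) (hb01 θ).1 hs) hn1.le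

/-! ### Clipped losses -/

section Clipped

variable {X A : Type*} [Fintype A] {d : ℕ} {φ : X → A → Params d}

lemma measurable_uncurry_softmaxProb [MeasurableSpace X]
    (hφ_meas : ∀ a, Measurable fun x => φ x a) (a : A) :
    Measurable fun p : Params d × X => softmaxProb φ p.1 p.2 a := by
  have h : ∀ a, Measurable fun p : Params d × X => φ p.2 a := fun a =>
    (hφ_meas a).comp measurable_snd
  unfold softmaxProb
  fun_prop

/-- The rescaled clipped loss `1 - τ r ς_θ(a | x) / max {p, τ}` of the parameter `θ`, with the
reward truncated to the unit interval. -/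
noncomputable def clippedLoss (φ : X → A → Params d) (τ : ℝ) (θ : Params d) (z : Example X A) : ℝ :=
  1 - max 0 (min z.2.2.2 1) * (softmaxProb φ θ z.1 z.2.1 * (τ / max z.2.2.1 τ))

variable [Nonempty A]

/-- The factor τ cancels the largest importance weight 1/τ. Truncating the reward makes the range
hold at every example, as the PAC-Bayes event requires, although sampled rewards already lie in
[0,1] almost surely. -/
lemma clippedLoss_gain_mem_Icc {τ : ℝ} (hτ : 0 < τ) (θ : Params d) (z : Example X A) :
    max 0 (min z.2.2.2 1) * (softmaxProb φ θ z.1 z.2.1 * (τ / max z.2.2.1 τ))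
      ∈ Set.Icc (0 : ℝ) 1 := by
  have h0 := softmaxProb_nonneg φ θ z.1 z.2.1
  have h1 := softmaxProb_le_one φ θ z.1 z.2.1
  have hm : 0 < max z.2.2.1 τ := lt_max_of_lt_right hτ
  have h2 : τ / max z.2.2.1 τ ≤ 1 := (div_le_one hm).2 (le_max_right _ _)
  have h3 : 0 ≤ τ / max z.2.2.1 τ := by positivity
  have h4 : max 0 (min z.2.2.2 1) ≤ 1 := max_le zero_le_one (min_le_right _ _)
  exact ⟨by positivity, mul_le_one₀ h4 (by positivity) (mul_le_one₀ h1 h3 h2)⟩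

lemma clippedLoss_mem_Icc {τ : ℝ} (hτ : 0 < τ) (θ : Params d) (z : Example X A) :
    clippedLoss φ τ θ z ∈ Set.Icc (0 : ℝ) 1 := by
  obtain ⟨h0, h1⟩ := clippedLoss_gain_mem_Icc (φ := φ) hτ θ z
  exact ⟨by unfold clippedLoss; linarith, by unfold clippedLoss; linarith⟩

/-- The empirical clipped loss of the posterior is controlled by the clipped risk estimate. -/
lemma integral_empMean_clippedLoss_le {n : ℕ} (hn : 0 < n) {B : ℝ} (hφ : ∀ x a, ‖φ x a‖ ≤ B)
    {τ : ℝ} (hτ : 0 < τ) (μ : Params d) {v : ℝ} (hv : 0 ≤ v) {S : Fin n → Example X A}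
    (hS : ∀ i, (S i).2.2.2 ∈ Set.Icc (0 : ℝ) 1) :
    ∫ θ, empMean (clippedLoss φ τ θ) S
        ∂(multivariateGaussian μ (v • (1 : Matrix (Fin d) (Fin d) ℝ)))
      ≤ 1 - τ + τ * clippedRisk φ B τ μ v S := by
  have hn' : (0 : ℝ) < n := Nat.cast_pos.2 hn
  set Q := multivariateGaussian μ (v • (1 : Matrix (Fin d) (Fin d) ℝ))
  set k : Fin n → ℝ := fun i => (S i).2.2.2 * (τ / max (S i).2.2.1 τ) with hk_def
  have hk : ∀ i, 0 ≤ k i := fun i =>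
    mul_nonneg (hS i).1 (div_nonneg hτ.le (hτ.le.trans (le_max_right _ _)))
  have hint : ∀ i, Integrable (fun θ => k i * softmaxProb φ θ (S i).1 (S i).2.1) Q := fun i =>
    (integrable_softmaxProb φ Q _ _).const_mul _
  have hemp : ∀ θ, empMean (clippedLoss φ τ θ) S
      = 1 - 1 / n * ∑ i, k i * softmaxProb φ θ (S i).1 (S i).2.1 := fun θ => by
    have h : ∀ i, clippedLoss φ τ θ (S i) = 1 - k i * softmaxProb φ θ (S i).1 (S i).2.1 :=
      fun i => by
        rw [clippedLoss, min_eq_left (hS i).2, max_eq_right (hS i).1, hk_def]; ring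
    simp_rw [empMean, h]
    rw [Finset.sum_sub_distrib, mul_sub]
    simp [hn'.ne']
  simp_rw [hemp]
  rw [integral_sub (integrable_const _) ((integrable_finsetSum _ fun i _ => hint i).const_mul _),
    integral_const_mul, integral_finsetSum _ fun i _ => hint i]
  simp only [integral_const, probReal_univ, one_smul, integral_const_mul]
  have hsum : ∑ i, k i * (Real.exp (-(1 / 2) * v * B ^ 2) * softmaxProb φ μ (S i).1 (S i).2.1)
      ≤ ∑ i, k i * ∫ θ, softmaxProb φ θ (S i).1 (S i).2.1 ∂Q :=
    Finset.sum_le_sum fun i _ => mul_le_mul_of_nonneg_left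
      (exp_mul_softmaxProb_le_integral φ hφ μ hv _ _) (hk i)
  have hrisk : 1 - τ + τ * clippedRisk φ B τ μ v S = 1 - 1 / n *
      ∑ i, k i * (Real.exp (-(1 / 2) * v * B ^ 2) * softmaxProb φ μ (S i).1 (S i).2.1) := by
    rw [clippedRisk, mul_sub, mul_one, Finset.mul_sum, Finset.mul_sum, Finset.mul_sum]
    rw [sub_add_sub_cancel]
    congr 1
    refine Finset.sum_congr rfl fun i _ => ?_
    rw [hk_def]; ring
  rw [hrisk]
  have := mul_le_mul_of_nonneg_left hsum (by positivity : (0 : ℝ) ≤ 1 / n)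
  linarith

/-- Needed to exchange the parameter and context integrals. -/
lemma integrable_uncurry_reward_mul_softmaxProb [MeasurableSpace X] {R : Type*}
    [MeasurableSpace R] {D : Measure (X × R)} [IsProbabilityMeasure D] {rew : R → X → A → ℝ}
    (hrew : ∀ ρ x a, rew ρ x a ∈ Set.Icc (0 : ℝ) 1)
    (hrew_meas : ∀ a, Measurable fun z : X × R => rew z.2 z.1 a)
    (hφ_meas : ∀ a, Measurable fun x => φ x a) (Q : Measure (Params d)) [IsProbabilityMeasure Q] :
    Integrable (Function.uncurry fun (θ : Params d) (z : X × R) =>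
      ∑ a, rew z.2 z.1 a * softmaxProb φ θ z.1 a) (Q.prod D) := by
  have hrew' : ∀ a, Measurable fun p : Params d × (X × R) => rew p.2.2 p.2.1 a := fun a =>
    (hrew_meas a).comp measurable_snd
  have hsplit : Measurable fun p : Params d × (X × R) => (p.1, p.2.1) := by fun_prop
  have hsoft := fun a => (measurable_uncurry_softmaxProb hφ_meas a).comp hsplit
  simp only [Function.comp_def] at hsoft
  have hterm : ∀ a, Integrable (fun p : Params d × (X × R) =>
      rew p.2.2 p.2.1 a * softmaxProb φ p.1 p.2.1 a) (Q.prod D) := fun a => by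
    refine Integrable.of_bound ((hrew' a).mul (hsoft a)).aestronglyMeasurable 1
      (.of_forall fun p => ?_)
    have h0 := softmaxProb_nonneg φ p.1 p.2.1 a
    rw [Real.norm_of_nonneg (mul_nonneg (hrew _ _ _).1 h0)]
    exact mul_le_one₀ (hrew _ _ _).2 h0 (softmaxProb_le_one φ p.1 p.2.1 a)
  exact integrable_finsetSum Finset.univ fun a _ => hterm a

end Clipped

/-! ### Logged data -/

section Logged

variable {X R A : Type*} [MeasurableSpace X] [MeasurableSpace R]
    [Fintype A] [MeasurableSpace A] [DiscreteMeasurableSpace A]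
    {D : Measure (X × R)} {rew : R → X → A → ℝ} {π₀ : Kernel X A}

lemma measurable_loggedExample (hrew_meas : ∀ a, Measurable fun z : X × R => rew z.2 z.1 a) :
    Measurable fun z : (X × R) × A =>
      ((z.1.1, z.2, (π₀ z.1.1).real {z.2}, rew z.1.2 z.1.1 z.2) : Example X A) := by
  refine measurable_from_prod_countable_left fun a => ?_
  have h1 : Measurable fun z : X × R => (π₀ z.1).real {a} :=
    (π₀.measurable_coe (measurableSet_singleton a)).ennreal_toReal.comp measurable_fst
  exact measurable_fst.prodMk (measurable_const.prodMk (h1.prodMk (hrew_meas a)))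

lemma isProbabilityMeasure_exampleLaw [IsProbabilityMeasure D] [IsMarkovKernel π₀]
    (hrew_meas : ∀ a, Measurable fun z : X × R => rew z.2 z.1 a) :
    IsProbabilityMeasure (exampleLaw D rew π₀) :=
  Measure.isProbabilityMeasure_map (measurable_loggedExample hrew_meas).aemeasurable

lemma ae_reward_mem_Icc (hrew : ∀ ρ x a, rew ρ x a ∈ Set.Icc (0 : ℝ) 1)
    (hrew_meas : ∀ a, Measurable fun z : X × R => rew z.2 z.1 a) :
    ∀ᵐ z ∂(exampleLaw D rew π₀), z.2.2.2 ∈ Set.Icc (0 : ℝ) 1 := by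
  rw [exampleLaw, ae_map_iff (measurable_loggedExample hrew_meas).aemeasurable
    (measurableSet_Icc.preimage (by fun_prop : Measurable fun z : Example X A => z.2.2.2))]
  exact .of_forall fun z => hrew _ _ _

/-- Expectations of bounded functions of a logged example. -/
lemma integral_exampleLaw [IsProbabilityMeasure D] [IsMarkovKernel π₀]
    (hrew_meas : ∀ a, Measurable fun z : X × R => rew z.2 z.1 a)
    {f : Example X A → ℝ} (hf : Measurable f) {C : ℝ} (hC : ∀ z, ‖f z‖ ≤ C) :
    ∫ z, f z ∂(exampleLaw D rew π₀)
      = ∫ z, ∑ a, (π₀ z.1).real {a} * f (z.1, a, (π₀ z.1).real {a}, rew z.2 z.1 a) ∂D := by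
  have hm := measurable_loggedExample (π₀ := π₀) hrew_meas
  have hint : Integrable (fun z : (X × R) × A =>
      f (z.1.1, z.2, (π₀ z.1.1).real {z.2}, rew z.1.2 z.1.1 z.2))
      (D ⊗ₘ (π₀.comap Prod.fst measurable_fst)) :=
    Integrable.of_bound (hf.comp hm).aestronglyMeasurable C (.of_forall fun z => hC _)
  rw [exampleLaw, integral_map hm.aemeasurable hf.aestronglyMeasurable,
    Measure.integral_compProd hint]
  refine integral_congr_ae (.of_forall fun z => ?_)
  simp only [Kernel.comap_apply]
  rw [integral_fintype (Integrable.of_finite)]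
  rfl

variable {d : ℕ} {φ : X → A → Params d}

lemma measurable_uncurry_clippedLoss (hφ_meas : ∀ a, Measurable fun x => φ x a) (τ : ℝ) :
    Measurable (Function.uncurry (clippedLoss φ τ)) := by
  have h1 : Measurable fun q : (Params d × X) × A => softmaxProb φ q.1.1 q.1.2 q.2 :=
    measurable_from_prod_countable_left fun a => measurable_uncurry_softmaxProb hφ_meas a
  have hsplit : Measurable fun p : Params d × Example X A => ((p.1, p.2.1), p.2.2.1) := by fun_prop
  have h2 := h1.comp hsplit
  simp only [Function.comp_def] at h2
  have h3 : Measurable fun p : Params d × Example X A => max 0 (min p.2.2.2.2 1) :=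
    measurable_const.max (measurable_snd.snd.snd.snd.min measurable_const)
  have h4 : Measurable fun p : Params d × Example X A => τ / max p.2.2.2.1 τ :=
    measurable_const.div (measurable_snd.snd.snd.fst.max measurable_const)
  exact (h3.mul (h2.mul h4)).const_sub 1

variable [Nonempty A]

/-- Clipping the propensities is pessimistic about the reward of the softmax policy. -/
lemma one_sub_integral_clippedLoss_le [IsProbabilityMeasure D] [IsMarkovKernel π₀]
    (hrew : ∀ ρ x a, rew ρ x a ∈ Set.Icc (0 : ℝ) 1)
    (hrew_meas : ∀ a, Measurable fun z : X × R => rew z.2 z.1 a)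
    (hφ_meas : ∀ a, Measurable fun x => φ x a) {τ : ℝ} (hτ : 0 < τ) (θ : Params d) :
    1 - ∫ z, clippedLoss φ τ θ z ∂(exampleLaw D rew π₀)
      ≤ τ * ∫ z, ∑ a, rew z.2 z.1 a * softmaxProb φ θ z.1 a ∂D := by
  have := isProbabilityMeasure_exampleLaw (D := D) (π₀ := π₀) hrew_meas
  have hloss : Measurable (clippedLoss φ τ θ) :=
    (measurable_uncurry_clippedLoss hφ_meas τ).comp (measurable_const.prodMk measurable_id)
  have hlint : Integrable (clippedLoss φ τ θ) (exampleLaw D rew π₀) :=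
    Integrable.of_bound hloss.aestronglyMeasurable 1 (.of_forall fun z => by
      rw [Real.norm_of_nonneg (clippedLoss_mem_Icc hτ θ z).1]; exact (clippedLoss_mem_Icc hτ θ z).2)
  have h1 : 1 - ∫ z, clippedLoss φ τ θ z ∂(exampleLaw D rew π₀)
      = ∫ z, (1 - clippedLoss φ τ θ z) ∂(exampleLaw D rew π₀) := by
    rw [integral_sub (integrable_const _) hlint]; simp
  rw [h1, integral_exampleLaw hrew_meas (hloss.const_sub 1) (C := 1) (fun z => by
      obtain ⟨h0, h1⟩ := clippedLoss_mem_Icc (φ := φ) hτ θ z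
      rw [Real.norm_of_nonneg (by linarith)]; linarith), ← integral_const_mul]
  have hsoft : ∀ a, Measurable fun z : X × R => softmaxProb φ θ z.1 a := fun a =>
    (measurable_uncurry_softmaxProb hφ_meas a).comp (measurable_const.prodMk measurable_fst)
  refine integral_mono_of_nonneg (.of_forall fun z => Finset.sum_nonneg fun a _ =>
    mul_nonneg measureReal_nonneg (sub_nonneg.2 (clippedLoss_mem_Icc hτ θ _).2)) ?_
    (.of_forall fun z => ?_)
  · refine Integrable.const_mul (integrable_finsetSum _ fun a _ => ?_) τ
    refine Integrable.of_bound ((hrew_meas a).mul (hsoft a)).aestronglyMeasurable 1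
      (.of_forall fun z => ?_)
    have h0 := softmaxProb_nonneg φ θ z.1 a
    rw [Real.norm_of_nonneg (mul_nonneg (hrew _ _ _).1 h0)]
    exact mul_le_one₀ (hrew _ _ _).2 h0 (softmaxProb_le_one φ θ z.1 a)
  · simp only
    rw [Finset.mul_sum]
    refine Finset.sum_le_sum fun a _ => ?_
    have hr := hrew z.2 z.1 a
    set p := (π₀ z.1).real {a}
    have hm : 0 < max p τ := lt_max_of_lt_right hτ
    -- Sampling contributes a factor p and the clipped weight 1/max(p, τ), so the surviving factor
    -- is at most 1.
    have hp : p / max p τ ≤ 1 := (div_le_one hm).2 (le_max_left _ _)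
    have h0 : 0 ≤ τ * (rew z.2 z.1 a * softmaxProb φ θ z.1 a) :=
      mul_nonneg hτ.le (mul_nonneg hr.1 (softmaxProb_nonneg φ θ z.1 a))
    rw [clippedLoss, sub_sub_cancel]
    simp only
    rw [min_eq_left hr.2, max_eq_right hr.1]
    calc p * (rew z.2 z.1 a * (softmaxProb φ θ z.1 a * (τ / max p τ)))
        = p / max p τ * (τ * (rew z.2 z.1 a * softmaxProb φ θ z.1 a)) := by ring
      _ ≤ τ * (rew z.2 z.1 a * softmaxProb φ θ z.1 a) := mul_le_of_le_one_left h0 hp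

/-- The risk of the mixed logit policy as a Gaussian mixture. -/
lemma risk_mixedLogitPolicy [IsProbabilityMeasure D]
    (hrew : ∀ ρ x a, rew ρ x a ∈ Set.Icc (0 : ℝ) 1)
    (hrew_meas : ∀ a, Measurable fun z : X × R => rew z.2 z.1 a)
    (hφ_meas : ∀ a, Measurable fun x => φ x a) (μ : Params d) (v : ℝ) :
    risk D rew (mixedLogitPolicy φ μ v)
      = 1 - ∫ θ, ∫ z, ∑ a, rew z.2 z.1 a * softmaxProb φ θ z.1 a ∂D
        ∂(multivariateGaussian μ (v • (1 : Matrix (Fin d) (Fin d) ℝ))) := by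
  set Q := multivariateGaussian μ (v • (1 : Matrix (Fin d) (Fin d) ℝ))
  have hint := integrable_uncurry_reward_mul_softmaxProb (D := D) hrew hrew_meas hφ_meas Q
  rw [risk, integral_integral_swap hint]
  congr 1
  refine integral_congr_ae (.of_forall fun z => ?_)
  simp only
  have := isProbabilityMeasure_mixedLogitPolicy φ μ v z.1
  rw [integral_fintype Integrable.of_finite, integral_finsetSum _ fun a _ =>
    (integrable_softmaxProb φ Q z.1 a).const_mul _]
  refine Finset.sum_congr rfl fun a _ => ?_
  rw [mixedLogitPolicy_real_singleton, integral_const_mul, smul_eq_mul, mul_comm]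

end Logged

/-- The regularized minimizer concentrates around its mean. -/
lemma measureReal_norm_rerm_sub_integral_gt_le {X A : Type*} [MeasurableSpace X]
    [MeasurableSpace A] [Countable A] [MeasurableSingletonClass A] {d n : ℕ} (hn : 0 < n)
    (P : Measure (Example X A)) [IsProbabilityMeasure P]
    {ℓ : Params d → X → A → ℝ} (hℓ_nonneg : ∀ θ x a, 0 ≤ ℓ θ x a)
    (hℓ_meas : ∀ θ a, Measurable fun x => ℓ θ x a)
    (hℓ_convex : ∀ x a, ConvexOn ℝ Set.univ fun θ => ℓ θ x a)
    {L : ℝ≥0} (hℓ_lip : ∀ x a, LipschitzWith L fun θ => ℓ θ x a)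
    {lam : ℝ} (hlam : 0 < lam) {δ : ℝ} (hδ : δ ∈ Set.Ioo (0 : ℝ) 1) :
    (Measure.pi fun _ : Fin n => P).real {S | L / lam * √(2 * Real.log (4 / δ) / n)
      < ‖rerm ℓ lam S - ∫ S', rerm ℓ lam S' ∂(Measure.pi fun _ : Fin n => P)‖} ≤ δ / 2 := by
  have hn' : (0 : ℝ) < n := Nat.cast_pos.2 hn
  have hlog : 0 ≤ Real.log (4 / δ) :=
    Real.log_nonneg ((one_le_div hδ.1).2 (by linarith [hδ.2]))
  -- The bounded differences inequality needs a positive constant; for L = 0 the minimizer is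
  -- identically 0 and the strict event is empty.
  rcases eq_or_ne L 0 with rfl | hL
  · have hzero : ∀ S : Fin n → Example X A, rerm ℓ lam S = 0 := fun S =>
      norm_le_zero_iff.1 (by simpa using norm_rerm_le hn hℓ_nonneg hℓ_convex hℓ_lip hlam S)
    simp only [hzero, integral_zero]
    have hδ0 := hδ.1
    simp only [sub_self, norm_zero, NNReal.coe_zero, zero_div, zero_mul, lt_irrefl]
    simp only [Set.ofPred_false, measureReal_empty]
    positivity
  · have hL' : (0 : ℝ) < L := NNReal.coe_pos.2 (pos_iff_ne_zero.2 hL)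
    have hmono : (Measure.pi fun _ : Fin n => P).real {S | L / lam * √(2 * Real.log (4 / δ) / n)
        < ‖rerm ℓ lam S - ∫ S', rerm ℓ lam S' ∂(Measure.pi fun _ : Fin n => P)‖}
        ≤ (Measure.pi fun _ : Fin n => P).real {S | L / lam * √(2 * Real.log (4 / δ) / n)
        ≤ ‖rerm ℓ lam S - ∫ S', rerm ℓ lam S' ∂(Measure.pi fun _ : Fin n => P)‖} :=
      measureReal_mono fun S hS => by
        simp only [Set.mem_ofPred_eq] at hS ⊢
        exact hS.le
    refine hmono.trans
      ((measureReal_norm_sub_integral_ge_le P hn (c := L / (n * lam)) (by positivity)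
        (measurable_rerm hℓ_nonneg hℓ_meas hℓ_convex hℓ_lip hlam)
        (norm_rerm_le hn hℓ_nonneg hℓ_convex hℓ_lip hlam)
        (norm_rerm_update_sub_le hn hℓ_nonneg hℓ_convex hℓ_lip hlam) (by positivity)).trans_eq ?_)
    -- The radius is chosen so that the exponent is log(4/δ), giving probability 2·δ/4 = δ/2.
    have hexp : (L / lam * √(2 * Real.log (4 / δ) / n)) ^ 2 / (2 * n * (L / (n * lam)) ^ 2)
        = Real.log (4 / δ) := by
      rw [mul_pow, Real.sq_sqrt (by positivity)]
      field_simp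
    have hδ0 := hδ.1
    rw [hexp, Real.exp_neg, Real.exp_log (by positivity), inv_div]
    ring

/-- Rescaling the PAC-Bayes bound for the clipped loss to a bound for the risk. -/
lemma rescale_clipped_bound {R Rhat τ G m a b : ℝ} (hτ : 0 < τ) (hm : 0 < m) (hG : 0 ≤ G)
    (hR : 1 - b ≤ τ * (1 - R)) (ha : a ≤ 1 - τ + τ * Rhat)
    (hb : b ≤ a + √(2 * a * (G / 2 / m)) + 2 * (G / 2 / m)) :
    R ≤ Rhat + √((Rhat - 1 + 1 / τ) * G / (τ * m)) + G / (τ * m) := by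
  have hε : 0 ≤ G / m := by positivity
  have hsqrt : √(2 * a * (G / 2 / m)) ≤ √((1 - τ + τ * Rhat) * (G / m)) :=
    Real.sqrt_le_sqrt (by
      rw [show 2 * a * (G / 2 / m) = a * (G / m) by ring]
      exact mul_le_mul_of_nonneg_right ha hε)
  have hscale : τ * √((Rhat - 1 + 1 / τ) * G / (τ * m)) = √((1 - τ + τ * Rhat) * (G / m)) := by
    rw [show (1 - τ + τ * Rhat) * (G / m) = τ ^ 2 * ((Rhat - 1 + 1 / τ) * G / (τ * m)) by
      field_simp; ring, Real.sqrt_mul (sq_nonneg τ), Real.sqrt_sq hτ.le]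
  have hlast : τ * (G / (τ * m)) = G / m := by field_simp
  refine le_of_mul_le_mul_left ?_ hτ
  rw [mul_add, mul_add, hscale, hlast]
  have : 2 * (G / 2 / m) = G / m := by ring
  linarith

/-- The expected clipped loss of the posterior bounds the risk of the mixed logit policy. -/
lemma one_sub_integral_integral_clippedLoss_le {X R A : Type*} [MeasurableSpace X]
    [MeasurableSpace R] [Fintype A] [Nonempty A] [MeasurableSpace A] [DiscreteMeasurableSpace A]
    {d : ℕ} {D : Measure (X × R)} {rew : R → X → A → ℝ} {π₀ : Kernel X A} {φ : X → A → Params d}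
    [IsProbabilityMeasure D] [IsMarkovKernel π₀]
    (hrew : ∀ ρ x a, rew ρ x a ∈ Set.Icc (0 : ℝ) 1)
    (hrew_meas : ∀ a, Measurable fun z : X × R => rew z.2 z.1 a)
    (hφ_meas : ∀ a, Measurable fun x => φ x a) {τ : ℝ} (hτ : 0 < τ) (μ : Params d) (v : ℝ) :
    1 - ∫ θ, ∫ z, clippedLoss φ τ θ z ∂(exampleLaw D rew π₀)
        ∂(multivariateGaussian μ (v • (1 : Matrix (Fin d) (Fin d) ℝ)))
      ≤ τ * (1 - risk D rew (mixedLogitPolicy φ μ v)) := by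
  have := isProbabilityMeasure_exampleLaw (D := D) (π₀ := π₀) hrew_meas
  rw [risk_mixedLogitPolicy hrew hrew_meas hφ_meas, sub_sub_cancel]
  set Q := multivariateGaussian μ (v • (1 : Matrix (Fin d) (Fin d) ℝ))
  have hloss := measurable_uncurry_clippedLoss (φ := φ) hφ_meas τ
  have h01 : ∀ θ, ∫ z, clippedLoss φ τ θ z ∂(exampleLaw D rew π₀) ∈ Set.Icc (0 : ℝ) 1 := fun θ =>
    integral_mem_Icc (hloss.comp (measurable_const.prodMk measurable_id))
      (clippedLoss_mem_Icc hτ θ)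
  have hmeas : Measurable fun θ => ∫ z, clippedLoss φ τ θ z ∂(exampleLaw D rew π₀) :=
    hloss.stronglyMeasurable.integral_prod_right.measurable
  have hint : Integrable (fun θ => ∫ z, clippedLoss φ τ θ z ∂(exampleLaw D rew π₀)) Q :=
    Integrable.of_bound hmeas.aestronglyMeasurable 1 (.of_forall fun θ => by
      rw [Real.norm_of_nonneg (h01 θ).1]; exact (h01 θ).2)
  have h1 : 1 - ∫ θ, ∫ z, clippedLoss φ τ θ z ∂(exampleLaw D rew π₀) ∂Q
      = ∫ θ, (1 - ∫ z, clippedLoss φ τ θ z ∂(exampleLaw D rew π₀)) ∂Q := by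
    rw [integral_sub (integrable_const _) hint]; simp
  rw [h1, ← integral_const_mul]
  refine integral_mono_of_nonneg (.of_forall fun θ => sub_nonneg.2 (h01 θ).2) ?_
    (.of_forall fun θ => one_sub_integral_clippedLoss_le hrew hrew_meas hφ_meas hτ θ)
  exact (integrable_uncurry_reward_mul_softmaxProb hrew hrew_meas hφ_meas
    Q).integral_prod_left.const_mul τ

end BayesCRM

/-! ### Assembly of the risk bound. -/

open BayesCRM in
theorem mainTheorem3 {X R A : Type*} [MeasurableSpace X] [MeasurableSpace R]
    [Fintype A] [Nonempty A] [MeasurableSpace A] [DiscreteMeasurableSpace A]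
    {d n : ℕ} (hn : 2 ≤ n)
    -- distribution over contexts and `[0,1]`-valued reward functions
    (D : Measure (X × R)) [IsProbabilityMeasure D]
    (rew : R → X → A → ℝ) (hrew : ∀ ρ x a, rew ρ x a ∈ Set.Icc (0 : ℝ) 1)
    (hrew_meas : ∀ a, Measurable fun z : X × R => rew z.2 z.1 a)
    -- logging policy with full support
    (π₀ : Kernel X A) [IsMarkovKernel π₀] (hπ₀ : ∀ x a, 0 < π₀ x {a})
    -- bounded features
    (φ : X → A → Params d) (hφ_meas : ∀ a, Measurable fun x => φ x a)
    (B : ℝ) (hφ : ∀ x a, ‖φ x a‖ ≤ B)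
    -- loss for estimating the logging policy, convex and `L`-Lipschitz in the parameters
    (ℓ : Params d → X → A → ℝ) (hℓ_nonneg : ∀ θ x a, 0 ≤ ℓ θ x a)
    (hℓ_meas : ∀ θ a, Measurable fun x => ℓ θ x a)
    (hℓ_convex : ∀ x a, ConvexOn ℝ Set.univ fun θ => ℓ θ x a)
    (L : ℝ≥0) (hℓ_lip : ∀ x a, LipschitzWith L fun θ => ℓ θ x a)
    (lam : ℝ) (hlam : 0 < lam)
    (δ : ℝ) (hδ : δ ∈ Set.Ioo (0 : ℝ) 1) (τ : ℝ) (hτ : τ ∈ Set.Ioo (0 : ℝ) 1)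
    (v₀ : ℝ) (hv₀ : 0 < v₀) :
    ∃ E : Set (Fin n → Example X A), MeasurableSet E ∧
      1 - δ ≤ (dataLaw D rew π₀ n).real E ∧
      ∀ S ∈ E, ∀ (μ : Params d) (v : ℝ), 0 < v → v ≤ v₀ →
        risk D rew (mixedLogitPolicy φ μ v) ≤
          clippedRisk φ B τ μ v S
          + √((clippedRisk φ B τ μ v S - 1 + 1 / τ)
              * (klBound n L lam δ (rerm ℓ lam S) v₀ μ v + 2 * Real.log (2 * n / δ))
              / (τ * ((n : ℝ) - 1)))
          + (klBound n L lam δ (rerm ℓ lam S) v₀ μ v + 2 * Real.log (2 * n / δ))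
              / (τ * ((n : ℝ) - 1)) := by
  have hn0 : 0 < n := by omega
  have hn1 : (0 : ℝ) < (n : ℝ) - 1 := by
    have : (2 : ℝ) ≤ n := by exact_mod_cast hn
    linarith
  have hδ0 := hδ.1
  have hP := isProbabilityMeasure_exampleLaw (D := D) (π₀ := π₀) hrew_meas
  set P := exampleLaw D rew π₀ with hP_def
  set θbar : Params d := ∫ S', rerm ℓ lam S' ∂(Measure.pi fun _ : Fin n => P) with hθbar
  set prior := multivariateGaussian θbar (v₀ • (1 : Matrix (Fin d) (Fin d) ℝ)) with hprior
  -- Half of δ is spent here, whence log(2n/δ), and half on the concentration of the minimizer.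
  obtain ⟨E, hE_meas, hE_prob, hE⟩ := exists_pacBayes_event P prior
    (measurable_uncurry_clippedLoss hφ_meas τ) (clippedLoss_mem_Icc hτ.1) hn
    (half_pos hδ0)
  set T : Set (Fin n → Example X A) :=
    {S | L / lam * √(2 * Real.log (4 / δ) / n) < ‖rerm ℓ lam S - θbar‖} with hT
  have hrerm : Measurable (rerm (n := n) ℓ lam) :=
    measurable_rerm hℓ_nonneg hℓ_meas hℓ_convex hℓ_lip hlam
  have hT_meas : MeasurableSet T := measurableSet_lt measurable_const (hrerm.sub_const θbar).norm
  have hT_prob : (Measure.pi fun _ : Fin n => P).real T ≤ δ / 2 :=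
    measureReal_norm_rerm_sub_integral_gt_le hn0 P hℓ_nonneg hℓ_meas hℓ_convex hℓ_lip hlam hδ
  -- On this almost sure event the reward truncation in `clippedLoss` is inactive.
  set N : Set (Fin n → Example X A) := {S | ∀ i, (S i).2.2.2 ∈ Set.Icc (0 : ℝ) 1} with hN
  have hN_meas : MeasurableSet N := by
    have : N = ⋂ i, {S : Fin n → Example X A | (S i).2.2.2 ∈ Set.Icc (0 : ℝ) 1} := by
      ext S; simp [hN]
    rw [this]
    exact MeasurableSet.iInter fun i => measurableSet_Icc.preimage (by fun_prop)
  have hN_prob : (Measure.pi fun _ : Fin n => P).real Nᶜ = 0 := by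
    have hae : ∀ᵐ S ∂(Measure.pi fun _ : Fin n => P), ∀ i, (S i).2.2.2 ∈ Set.Icc (0 : ℝ) 1 :=
      ae_all_iff.2 fun i => (measurePreserving_eval (fun _ : Fin n => P) i).quasiMeasurePreserving.ae
        (ae_reward_mem_Icc hrew hrew_meas)
    exact (measureReal_eq_zero_iff).2 (mem_ae_iff.1 hae)
  have hG_meas : MeasurableSet (E ∩ Tᶜ ∩ N) := (hE_meas.inter hT_meas.compl).inter hN_meas
  refine ⟨E ∩ Tᶜ ∩ N, hG_meas, ?_, ?_⟩
  · have hcompl : (E ∩ Tᶜ ∩ N)ᶜ = (Eᶜ ∪ T) ∪ Nᶜ := by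
      rw [Set.compl_inter, Set.compl_inter, compl_compl]
    have h1 : (Measure.pi fun _ : Fin n => P).real (E ∩ Tᶜ ∩ N)ᶜ ≤ δ := by
      rw [hcompl]
      have h2 := measureReal_union_le (μ := Measure.pi fun _ : Fin n => P) (Eᶜ ∪ T) Nᶜ
      have h3 := measureReal_union_le (μ := Measure.pi fun _ : Fin n => P) Eᶜ T
      linarith
    rw [probReal_compl_eq_one_sub hG_meas] at h1
    change 1 - δ ≤ (Measure.pi fun _ : Fin n => P).real (E ∩ Tᶜ ∩ N)
    linarith
  · rintro S ⟨⟨hSE, hST⟩, hSN⟩ μ v hv hvv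
    obtain ⟨ψ, hψ, hQ, hψint, hψle⟩ := exists_logDensity_multivariateGaussian μ θbar hv hvv
    set Q := multivariateGaussian μ (v • (1 : Matrix (Fin d) (Fin d) ℝ)) with hQ_def
    -- The unobservable centre `θbar` is replaced by the minimizer at the cost of the concentration
    -- radius. `klBound` is twice the relative entropy bound, hence the halving.
    have hkl : ∫ θ, ψ θ ∂Q ≤ klBound n L lam δ (rerm ℓ lam S) v₀ μ v / 2 := by
      refine hψle.trans ?_
      have hdist : ‖rerm ℓ lam S - θbar‖ ≤ L / lam * √(2 * Real.log (4 / δ) / n) := not_lt.1 hST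
      have htri : ‖μ - θbar‖ ≤ ‖μ - rerm ℓ lam S‖ + L / lam * √(2 * Real.log (4 / δ) / n) := by
        have := norm_sub_le_norm_sub_add_norm_sub μ (rerm ℓ lam S) θbar
        linarith
      have hsq := div_le_div_of_nonneg_right (pow_le_pow_left₀ (norm_nonneg _) htri 2) hv₀.le
      unfold klBound
      linarith
    obtain ⟨hnonneg, hbound⟩ := hE S hSE Q ψ hψ hQ hψint _ hkl
    have hlog : Real.log (n / (δ / 2)) = Real.log (2 * n / δ) := by
      congr 1; field_simp
    set G := klBound n L lam δ (rerm ℓ lam S) v₀ μ v + 2 * Real.log (2 * n / δ) with hG_def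
    have hhalf : klBound n L lam δ (rerm ℓ lam S) v₀ μ v / 2 + Real.log (n / (δ / 2)) = G / 2 := by
      rw [hlog, hG_def]; ring
    rw [hhalf] at hnonneg hbound
    refine rescale_clipped_bound hτ.1 hn1 (by linarith) ?_
      (integral_empMean_clippedLoss_le hn0 hφ hτ.1 μ hv.le hSN) hbound
    exact one_sub_integral_integral_clippedLoss_le hrew hrew_meas hφ_meas hτ.1 μ v
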